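/- A boundaried graph $G_B$ is a finite simple graph $G$ with a set $B\subseteq V(G)$ of boundary vertices. For boundaried graphs $G_B,H_B$ with the same boundary, $G_B\oplus H_B$ denotes the simple graph obtained from the disjoint union of $G$ and $H$ by identifying the corresponding vertices of $B$. Let $\mathrm{OPT}_{VC}(Q)$ be the minimum size of a vertex cover of a graph $Q$. Vertex Cover parameterized by the size of a given vertex cover admits a polynomial boundaried kernelization with at most $2(|B|+k)$ vertices. That is, there is a polynomial-time algorithm that, given a boundaried graph $G_B$ and a vertex cover $X$ of $G$ of size $k$, outputs a boundaried graph $G'_B$ with the same boundary, a vertex cover $X'$ of $G'$, and an integer $\Delta$, such that (i) $\mathrm{OPT}_{VC}(G_B\oplus H_B)=\mathrm{OPT}_{VC}(G'_B\oplus H_B)+\Delta$ for every boundaried graph $H_B$; (ii) the encoding lengths of $G'_B$ and $X'$, and $|X'|$, are at most $p(|B|+k)$ for a fixed polynomial $p$; (iii) $|V(G')|\le 2(|B|+k)$. -/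

import Mathlib

/-! ### Boundaried graphs and gluing -/

/-- A boundaried graph: a graph on `V` whose boundary is a copy of `B` inside `V`. Two boundaried
graphs with the same `B` have the same boundary; `bd` says where each boundary vertex sits. -/
structure BoundariedGraph (B V : Type) where
  graph : SimpleGraph V
  bd : B ↪ V

namespace BoundariedGraph

/-- Adjacency in the glued graph. The vertices are those of the first graph (`Sum.inl`), and those
of the second graph that do not lie on the boundary (`Sum.inr`); the boundary vertex `H.bd i` is
identified with `G.bd i`. -/
def GlueAdj {B V W : Type} (G : BoundariedGraph B V) (H : BoundariedGraph B W) :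
    V ⊕ {w : W // w ∉ Set.range H.bd} → V ⊕ {w : W // w ∉ Set.range H.bd} → Prop
  | Sum.inl u, Sum.inl v =>
      G.graph.Adj u v ∨ ∃ i j, G.bd i = u ∧ G.bd j = v ∧ H.graph.Adj (H.bd i) (H.bd j)
  | Sum.inl u, Sum.inr w => ∃ i, G.bd i = u ∧ H.graph.Adj (H.bd i) w.1
  | Sum.inr w, Sum.inl u => ∃ i, G.bd i = u ∧ H.graph.Adj (H.bd i) w.1
  | Sum.inr w, Sum.inr w' => H.graph.Adj w.1 w'.1

/-- The gluing `G ⊕ H` of two boundaried graphs with the same boundary: the disjoint union with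
corresponding boundary vertices identified, as a simple graph. -/
def glue {B V W : Type} (G : BoundariedGraph B V) (H : BoundariedGraph B W) :
    SimpleGraph (V ⊕ {w : W // w ∉ Set.range H.bd}) where
  Adj := GlueAdj G H
  symm := ⟨by
    rintro (u | w) (v | w') h
    · rcases h with h | ⟨i, j, hi, hj, h⟩
      · exact Or.inl h.symm
      · exact Or.inr ⟨j, i, hj, hi, h.symm⟩
    · exact h
    · exact h
    · exact SimpleGraph.Adj.symm h⟩
  loopless := ⟨by
    rintro (u | w) h
    · rcases h with h | ⟨i, j, hi, hj, h⟩
      · exact h.ne rfl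
      · have hij : i = j := G.bd.injective (hi.trans hj.symm)
        exact h.ne (congrArg H.bd hij)
    · exact SimpleGraph.Adj.ne h rfl⟩

end BoundariedGraph

/-- The optimum value of Vertex Cover on a finite graph: the smallest size of a vertex cover. -/
noncomputable def vcOpt {V : Type} [Finite V] (G : SimpleGraph V) : ℕ :=
  G.vertexCoverNum.toNat

/-- `G` and `G'` are gluing equivalent with respect to Vertex Cover and their common boundary, with
offset `Δ`: for every (finite) boundaried graph `H` with this boundary,
`OPT(G ⊕ H) = OPT(G' ⊕ H) + Δ`. -/
def VCGluingEquiv {B V V' : Type} [Finite V] [Finite V']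
    (G : BoundariedGraph B V) (G' : BoundariedGraph B V') (Δ : ℤ) : Prop :=
  ∀ (W : Type) [Finite W] (H : BoundariedGraph B W),
    (vcOpt (G.glue H) : ℤ) = (vcOpt (G'.glue H) : ℤ) + Δ

/-! ### Polynomial time

Algorithms are random access programs in structured form. The memory consists of registers and of
arrays of registers, all holding natural numbers; a program mentions finitely many of them. The
arithmetic is addition and truncated subtraction only, so that (as usual for random access machines
without multiplication) a run of `t` steps can be simulated by a Turing machine in time polynomial
in `t` and the input length, and conversely. -/

namespace RAM

/-- The memory: registers `reg x`, and arrays with entries `arr a i`. -/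
structure Store where
  reg : ℕ → ℕ
  arr : ℕ → ℕ → ℕ

/-- Expressions. `read a e` is the entry of array `a` at the index that `e` evaluates to. -/
inductive Expr where
  | const (c : ℕ)
  | reg (x : ℕ)
  | read (a : ℕ) (e : Expr)
  | add (e₁ e₂ : Expr)
  | sub (e₁ e₂ : Expr)
  | eq (e₁ e₂ : Expr)
  | lt (e₁ e₂ : Expr)

/-- The value of an expression; `eq` and `lt` return `1` for true and `0` for false. -/
def Expr.eval (s : Store) : Expr → ℕ
  | .const c => c
  | .reg x => s.reg x
  | .read a e => s.arr a (e.eval s)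
  | .add e₁ e₂ => e₁.eval s + e₂.eval s
  | .sub e₁ e₂ => e₁.eval s - e₂.eval s
  | .eq e₁ e₂ => if e₁.eval s = e₂.eval s then 1 else 0
  | .lt e₁ e₂ => if e₁.eval s < e₂.eval s then 1 else 0

/-- Programs. A test `e` succeeds if its value is not `0`. -/
inductive Prog where
  | skip
  | assign (x : ℕ) (e : Expr)
  | write (a : ℕ) (i e : Expr)
  | seq (c₁ c₂ : Prog)
  | ite (e : Expr) (c₁ c₂ : Prog)
  | while (e : Expr) (c : Prog)

/-- Overwrite register `x`. -/
def Store.setReg (s : Store) (x v : ℕ) : Store where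
  reg := Function.update s.reg x v
  arr := s.arr

/-- Overwrite the entry of array `a` at index `i`. -/
def Store.setArr (s : Store) (a i v : ℕ) : Store where
  reg := s.reg
  arr := Function.update s.arr a (Function.update (s.arr a) i v)

/-- `Exec c s t s'`: started on the memory `s`, the program `c` halts with the memory `s'` after
exactly `t` steps. Every execution of `skip`, of an assignment, of a write or of a test is a step
(a program is fixed and contains finitely many expressions, so that charging for the size of the
expressions would change the number of steps by a constant factor only). -/
inductive Exec : Prog → Store → ℕ → Store → Prop where
  | skip (s : Store) : Exec .skip s 1 s
  | assign (s : Store) (x : ℕ) (e : Expr) : Exec (.assign x e) s 1 (s.setReg x (e.eval s))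
  | write (s : Store) (a : ℕ) (i e : Expr) :
      Exec (.write a i e) s 1 (s.setArr a (i.eval s) (e.eval s))
  | seq {c₁ c₂ : Prog} {s s' s'' : Store} {t₁ t₂ : ℕ} :
      Exec c₁ s t₁ s' → Exec c₂ s' t₂ s'' → Exec (.seq c₁ c₂) s (t₁ + t₂) s''
  | iteTrue {e : Expr} {c₁ c₂ : Prog} {s s' : Store} {t : ℕ} :
      e.eval s ≠ 0 → Exec c₁ s t s' → Exec (.ite e c₁ c₂) s (t + 1) s'
  | iteFalse {e : Expr} {c₁ c₂ : Prog} {s s' : Store} {t : ℕ} :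
      e.eval s = 0 → Exec c₂ s t s' → Exec (.ite e c₁ c₂) s (t + 1) s'
  | whileTrue {e : Expr} {c : Prog} {s s' s'' : Store} {t₁ t₂ : ℕ} :
      e.eval s ≠ 0 → Exec c s t₁ s' → Exec (.while e c) s' t₂ s'' →
      Exec (.while e c) s (t₁ + t₂ + 1) s''
  | whileFalse {e : Expr} {c : Prog} {s : Store} :
      e.eval s = 0 → Exec (.while e c) s 1 s

/-- The initial memory on the input string `w`: its length in register `0`, its bits in array `0`,
and `0` everywhere else. -/
def Store.init (w : List Bool) : Store where
  reg x := if x = 0 then w.length else 0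
  arr a i := if a = 0 ∧ w[i]? = some true then 1 else 0

/-- The memory `s` holds the output string `w`: its length in register `1`, and its bits at the
beginning of array `1`. -/
def Store.HasOutput (s : Store) (w : List Bool) : Prop :=
  s.reg 1 = w.length ∧ ∀ i, ∀ h : i < w.length, s.arr 1 i = if w[i] then 1 else 0

/-- One program transforms, for every `a : α`, the string `inp a` into the string `out a`, in a
number of steps that is polynomially bounded in the length of `inp a`. -/
def PolyTimeComputes {α : Type} (inp out : α → List Bool) : Prop :=
  ∃ (c : Prog) (p : Polynomial ℕ), ∀ a : α, ∃ (t : ℕ) (s : Store),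
    Exec c (Store.init (inp a)) t s ∧ t ≤ p.eval (inp a).length ∧ s.HasOutput (out a)

end RAM

/-! ### Boundaried kernelization for Vertex Cover parameterized by a given vertex cover -/

/-- A boundaried graph with `n` vertices and `b` boundary vertices, given with a vertex cover. -/
structure VCInstance (b : ℕ) where
  n : ℕ
  G : BoundariedGraph (Fin b) (Fin n)
  cover : Finset (Fin n)
  isCover : G.graph.IsVertexCover (cover : Set (Fin n))

open Classical in
/-- The encoding as a bit string: `n` and `b` in unary, the adjacency matrix, for each boundary
vertex the indicator vector of its position, and the indicator vector of the cover. -/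
noncomputable def VCInstance.encode {b : ℕ} (x : VCInstance b) : List Bool :=
  List.replicate x.n true ++ [false] ++ List.replicate b true ++ [false]
    ++ (List.finRange x.n).flatMap
        (fun u => (List.finRange x.n).map fun v => decide (x.G.graph.Adj u v))
    ++ (List.finRange b).flatMap
        (fun i => (List.finRange x.n).map fun v => decide (x.G.bd i = v))
    ++ (List.finRange x.n).map (fun v => decide (v ∈ x.cover))

/-- Integers as bit strings: the sign, followed by the absolute value in binary. -/
def encodeInt (z : ℤ) : List Bool :=
  decide (z < 0) :: Computability.encodeNat z.natAbs

/-- `f` is a polynomial boundaried kernelization for Vertex Cover parameterized by the size of a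
given vertex cover: it maps a boundaried graph with a vertex cover to a boundaried graph with the
same boundary and a vertex cover, together with an offset `Δ`. -/
structure IsPolyBoundariedKernelization (f : ∀ b : ℕ, VCInstance b → VCInstance b × ℤ) : Prop where
  polyTime : RAM.PolyTimeComputes (fun x : Σ b : ℕ, VCInstance b => x.2.encode)
    (fun x => (f x.1 x.2).1.encode ++ encodeInt (f x.1 x.2).2)
  gluingEquiv : ∀ (b : ℕ) (x : VCInstance b), VCGluingEquiv x.G (f b x).1.G (f b x).2
  /-- The length of the encoding of the output graph with its cover, and the size of this cover,
  are polynomially bounded in `|B| + k`, where `k` is the size of the given cover. -/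
  polySize : ∃ p : Polynomial ℕ, ∀ (b : ℕ) (x : VCInstance b),
    (f b x).1.encode.length ≤ p.eval (b + x.cover.card) ∧
      (f b x).1.cover.card ≤ p.eval (b + x.cover.card)

/-! Call the vertices of the cover and of the boundary terminals; there are at most `b + k` of them,
and the other vertices are independent. It suffices to find a matching of non-terminals into
terminals such that all unmatched non-terminals can be deleted with offset 0: terminals and matched
vertices then number at most `2 * (b + k)`.

The matching comes from an auction. An unmatched non-terminal bids for a cheapest neighbour, raises
its price by one and displaces its former partner; it is discarded once all its neighbours cost at
least `n + 1`. Prices only rise, so there are polynomially many bids. The invariant that matters is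
`Auction.slack`: a matched vertex holds a neighbour whose price exceeds that of any other neighbour
by at most one.

At the end, some price `j ≤ n` is held by none of the `n` vertices (`exists_crown`). Let `R` be the
set of vertices of price above `j`. They are matched; by slack and the gap at `j`, their partners
have neighbours only in `R`, and so do the discarded vertices. In any glued graph, the matching
edges at `R` need `|R|` cover vertices, which may be taken to be `R` itself, and these already cover
every edge at a discarded vertex (`vcGluingEquiv_of_crown`). Partners and discarded vertices lie off
the boundary, so gluing gives them no new neighbours.

For the running time, the auction is written as a concrete program, verified with a Hoare logic that
tracks steps. The program outputs the kernel as a submatrix of its input. -/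

/-! ### A program logic with time bounds -/

namespace RAM

/-- Whether the program contains an assignment to register `x`. -/
def Prog.setsReg : Prog → ℕ → Bool
  | .skip, _ => false
  | .assign x _, y => x == y
  | .write _ _ _, _ => false
  | .seq c₁ c₂, y => c₁.setsReg y || c₂.setsReg y
  | .ite _ c₁ c₂, y => c₁.setsReg y || c₂.setsReg y
  | .while _ c, y => c.setsReg y

/-- Whether the program contains a write to array `a`. -/
def Prog.setsArr : Prog → ℕ → Bool
  | .skip, _ => false
  | .assign _ _, _ => false
  | .write a _ _, a' => a == a'
  | .seq c₁ c₂, a => c₁.setsArr a || c₂.setsArr a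
  | .ite _ c₁ c₂, a => c₁.setsArr a || c₂.setsArr a
  | .while _ c, a => c.setsArr a

/-- The memories `s` and `s'` agree wherever the program `c` writes nothing. -/
structure Frame (c : Prog) (s s' : Store) : Prop where
  reg : ∀ y, c.setsReg y = false → s'.reg y = s.reg y
  arr : ∀ a, c.setsArr a = false → s'.arr a = s.arr a

theorem Frame.refl (c : Prog) (s : Store) : Frame c s s :=
  ⟨fun _ _ => rfl, fun _ _ => rfl⟩

theorem Frame.trans {c : Prog} {s s' s'' : Store} (h : Frame c s s') (h' : Frame c s' s'') :
    Frame c s s'' :=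
  ⟨fun y hy => (h'.reg y hy).trans (h.reg y hy), fun a ha => (h'.arr a ha).trans (h.arr a ha)⟩

theorem Frame.mono {c c' : Prog} {s s' : Store} (h : Frame c s s')
    (hr : ∀ y, c'.setsReg y = false → c.setsReg y = false)
    (ha : ∀ a, c'.setsArr a = false → c.setsArr a = false) : Frame c' s s' :=
  ⟨fun y hy => h.reg y (hr y hy), fun a h' => h.arr a (ha a h')⟩

/-- Specifications need to mention only what changes: the side conditions are Boolean computations,
closed by `rfl` for concrete programs. -/
theorem Exec.frame {c : Prog} {s s' : Store} {t : ℕ} (h : Exec c s t s') : Frame c s s' := by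
  induction h with
  | skip s => exact Frame.refl _ _
  | assign s x e =>
    refine ⟨fun y hy => ?_, fun _ _ => rfl⟩
    have : y ≠ x := by rintro rfl; simp [Prog.setsReg] at hy
    simp [Store.setReg, this]
  | write s a i e =>
    refine ⟨fun _ _ => rfl, fun a' ha => ?_⟩
    have : a' ≠ a := by rintro rfl; simp [Prog.setsArr] at ha
    simp [Store.setArr, this]
  | seq _ _ ih₁ ih₂ =>
    refine (ih₁.mono ?_ ?_).trans (ih₂.mono ?_ ?_) <;>
      simp +contextual [Prog.setsReg, Prog.setsArr]
  | iteTrue _ _ ih =>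
    refine ih.mono ?_ ?_ <;> simp +contextual [Prog.setsReg, Prog.setsArr]
  | iteFalse _ _ ih =>
    refine ih.mono ?_ ?_ <;> simp +contextual [Prog.setsReg, Prog.setsArr]
  | whileTrue _ _ _ ih₁ ih₂ =>
    refine Frame.trans (ih₁.mono ?_ ?_) ih₂ <;> simp +contextual [Prog.setsReg, Prog.setsArr]
  | whileFalse _ => exact Frame.refl _ _

/-- Started on `s`, the program `c` halts after at most `T` steps with a memory satisfying `Q`. -/
def Runs (c : Prog) (s : Store) (T : ℕ) (Q : Store → Prop) : Prop :=
  ∃ t s', Exec c s t s' ∧ t ≤ T ∧ Q s'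

namespace Runs

variable {c c₁ c₂ : Prog} {s : Store} {T T₁ T₂ : ℕ} {Q Q₁ : Store → Prop}

theorem mono (h : Runs c s T₁ Q₁) (hT : T₁ ≤ T) (hQ : ∀ s', Frame c s s' → Q₁ s' → Q s') :
    Runs c s T Q := by
  obtain ⟨t, s', h₁, h₂, h₃⟩ := h
  exact ⟨t, s', h₁, h₂.trans hT, hQ _ h₁.frame h₃⟩

theorem skip (h : Q s) : Runs .skip s 1 Q := ⟨1, s, .skip s, le_rfl, h⟩

theorem assign {x : ℕ} {e : Expr} (h : Q (s.setReg x (e.eval s))) : Runs (.assign x e) s 1 Q :=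
  ⟨1, _, .assign s x e, le_rfl, h⟩

theorem write {a : ℕ} {i e : Expr} (h : Q (s.setArr a (i.eval s) (e.eval s))) :
    Runs (.write a i e) s 1 Q :=
  ⟨1, _, .write s a i e, le_rfl, h⟩

theorem seq (h₁ : Runs c₁ s T₁ Q₁) (h₂ : ∀ s', Frame c₁ s s' → Q₁ s' → Runs c₂ s' T₂ Q) :
    Runs (.seq c₁ c₂) s (T₁ + T₂) Q := by
  obtain ⟨t₁, s₁, he₁, ht₁, hq₁⟩ := h₁
  obtain ⟨t₂, s₂, he₂, ht₂, hq₂⟩ := h₂ s₁ he₁.frame hq₁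
  exact ⟨_, s₂, he₁.seq he₂, Nat.add_le_add ht₁ ht₂, hq₂⟩

theorem assign_seq {x : ℕ} {e : Expr} (h : Runs c (s.setReg x (e.eval s)) T Q) :
    Runs (.seq (.assign x e) c) s (T + 1) Q := by
  obtain ⟨t, s', he, ht, hq⟩ := h
  exact ⟨_, s', (Exec.assign s x e).seq he, by omega, hq⟩

theorem write_seq {a : ℕ} {i e : Expr} (h : Runs c (s.setArr a (i.eval s) (e.eval s)) T Q) :
    Runs (.seq (.write a i e) c) s (T + 1) Q := by
  obtain ⟨t, s', he, ht, hq⟩ := h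
  exact ⟨_, s', (Exec.write s a i e).seq he, by omega, hq⟩

theorem ite {e : Expr} (h₁ : e.eval s ≠ 0 → Runs c₁ s T Q) (h₂ : e.eval s = 0 → Runs c₂ s T Q) :
    Runs (.ite e c₁ c₂) s (T + 1) Q := by
  by_cases h : e.eval s = 0
  · obtain ⟨t, s', he, ht, hq⟩ := h₂ h
    exact ⟨_, s', .iteFalse h he, by omega, hq⟩
  · obtain ⟨t, s', he, ht, hq⟩ := h₁ h
    exact ⟨_, s', .iteTrue h he, by omega, hq⟩

/-- Total correctness of a loop, with an invariant `I` and a decreasing measure `μ`. -/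
theorem while_measure {e : Expr} (I : Store → Prop) (μ : Store → ℕ) (hI : I s)
    (h : ∀ s', Frame c s s' → I s' → e.eval s' ≠ 0 →
      Runs c s' T (fun s'' => I s'' ∧ μ s'' < μ s')) :
    Runs (.while e c) s (μ s * (T + 1) + 1) (fun s' => I s' ∧ e.eval s' = 0) := by
  -- Induction on a bound for the measure, with the frame kept relative to the initial memory `s`.
  suffices H : ∀ m s', Frame c s s' → I s' → μ s' ≤ m →
      Runs (.while e c) s' (m * (T + 1) + 1) (fun s' => I s' ∧ e.eval s' = 0) from
    H _ s (Frame.refl _ _) hI le_rfl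
  intro m
  induction m with
  | zero =>
    intro s' hf hs hm
    by_cases he : e.eval s' = 0
    · exact ⟨1, s', .whileFalse he, by omega, hs, he⟩
    · obtain ⟨t, s'', -, -, -, hlt⟩ := h s' hf hs he
      omega
  | succ m ih =>
    intro s' hf hs hm
    by_cases he : e.eval s' = 0
    · exact ⟨1, s', .whileFalse he, by omega, hs, he⟩
    · obtain ⟨t, s'', he₁, ht, hs'', hlt⟩ := h s' hf hs he
      obtain ⟨t', s₃, he₂, ht', hq⟩ := ih s'' (hf.trans he₁.frame) hs'' (by omega)
      refine ⟨_, s₃, .whileTrue he he₁ he₂, ?_, hq⟩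
      rw [Nat.succ_mul]
      omega

/-- Total correctness of a loop whose body is executed for the values `k, ..., m - 1` of a
counter. -/
theorem while_count {e : Expr} (I : ℕ → Store → Prop) (k m : ℕ) (hkm : k ≤ m) (hI : I k s)
    (htest : ∀ i s', k ≤ i → i ≤ m → Frame c s s' → I i s' → (e.eval s' ≠ 0 ↔ i < m))
    (h : ∀ i s', k ≤ i → i < m → Frame c s s' → I i s' → Runs c s' T (I (i + 1))) :
    Runs (.while e c) s (m * (T + 1) + 1) (I m) := by
  suffices H : ∀ d s' i, i + d = m → k ≤ i → Frame c s s' → I i s' →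
      Runs (.while e c) s' (d * (T + 1) + 1) (I m) by
    refine (H (m - k) s k (by omega) le_rfl (Frame.refl _ _) hI).mono ?_ (fun _ _ h => h)
    gcongr
    omega
  intro d
  induction d with
  | zero =>
    intro s' i hi hk hf hs
    obtain rfl : i = m := hi
    refine ⟨1, s', .whileFalse ?_, by omega, hs⟩
    by_contra he
    exact absurd ((htest i s' hk le_rfl hf hs).1 he) (by omega)
  | succ d ih =>
    intro s' i hi hk hf hs
    obtain ⟨t, s'', he₁, ht, hs''⟩ := h i s' hk (by omega) hf hs
    obtain ⟨t', s₃, he₂, ht', hq⟩ := ih s'' (i + 1) (by omega) (by omega) (hf.trans he₁.frame) hs''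
    refine ⟨_, s₃, .whileTrue ((htest i s' hk (by omega) hf hs).2 (by omega)) he₁ he₂, ?_, hq⟩
    rw [Nat.succ_mul]
    omega

end Runs

/-- `c` is executed for `x = lo, ..., hi - 1`. -/
def Prog.for (x : ℕ) (lo hi : Expr) (c : Prog) : Prog :=
  .seq (.assign x lo) (.while (.lt (.reg x) hi) (.seq c (.assign x (.add (.reg x) (.const 1)))))

/-- Each round costs the body, the increment and a test; initialisation and the last test add 2. The
bound `hi` is re-evaluated at every test, hence `hhi`. -/
theorem Runs.for_loop {c : Prog} {s : Store} {T x : ℕ} {lo hi : Expr} (I : ℕ → Store → Prop)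
    (k m : ℕ) (hk : lo.eval s = k) (hkm : k ≤ m) (hx : c.setsReg x = false)
    (hhi : ∀ s', Frame (.for x lo hi c) s s' → hi.eval s' = m)
    (hI : I k (s.setReg x k))
    (h : ∀ i s', k ≤ i → i < m → Frame (.for x lo hi c) s s' → s'.reg x = i → I i s' →
      Runs c s' T (fun s'' => I (i + 1) (s''.setReg x (i + 1)))) :
    Runs (.for x lo hi c) s (m * (T + 2) + 2) (I m) := by
  have hfr : ∀ s', Frame (.seq c (.assign x (.add (.reg x) (.const 1)))) (s.setReg x k) s' →
      Frame (.for x lo hi c) s s' := by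
    intro s' hf
    refine ((Exec.assign s x lo).frame.mono ?_ ?_).trans ((hk ▸ hf).mono ?_ ?_) <;>
      simp +contextual [Prog.for, Prog.setsReg, Prog.setsArr]
  refine Runs.assign_seq (T := m * (T + 1 + 1) + 1) ?_
  rw [hk]
  refine (Runs.while_count (fun i s' => s'.reg x = i ∧ I i s') k m hkm
    ⟨by simp [Store.setReg], hI⟩ ?_ ?_).mono le_rfl (fun _ _ h => h.2)
  · rintro i s' - - hf ⟨hxi, -⟩
    simp [Expr.eval, hxi, hhi s' (hfr s' hf)]
  · rintro i s' hki him hf ⟨hxi, hs'⟩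
    refine Runs.seq (h i s' hki him (hfr s' hf) hxi hs') (fun s'' hf' hs'' => Runs.assign ?_)
    have : s''.reg x = i := (hf'.reg x hx).trans hxi
    simp only [Expr.eval, this]
    exact ⟨by simp [Store.setReg], hs''⟩

/-! ### Effect of updates on the memory. -/

@[simp]
theorem Store.setReg_reg (s : Store) (x v y : ℕ) :
    (s.setReg x v).reg y = if y = x then v else s.reg y := by
  simp [Store.setReg, Function.update_apply]

@[simp]
theorem Store.setReg_arr (s : Store) (x v : ℕ) : (s.setReg x v).arr = s.arr := rfl

@[simp]
theorem Store.setArr_reg (s : Store) (a i v : ℕ) : (s.setArr a i v).reg = s.reg := rfl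

@[simp]
theorem Store.setArr_arr (s : Store) (a i v a' : ℕ) :
    (s.setArr a i v).arr a' = if a' = a then Function.update (s.arr a) i v else s.arr a' := by
  simp [Store.setArr, Function.update_apply]

end RAM

namespace RAM

/-! ### Reading the input -/

/-- The string `w` consists of `n` and `b` in unary, followed by the rows of the bit matrix `M` with
`n + b + 1` rows and `n` columns. -/
structure IsMatrixInput (n b : ℕ) (M : ℕ → ℕ → Bool) (w : List Bool) : Prop where
  vertex : ∀ i < n, w[i]? = some true
  vertex_end : w[n]? = some false
  boundary : ∀ i < b, w[n + 1 + i]? = some true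
  boundary_end : w[n + 1 + b]? = some false
  entry : ∀ r < n + b + 1, ∀ c < n, w[n + b + 2 + r * n + c]? = some (M r c)

/-- The memory holds the bit matrix `M`, whose rows start in array `0` at the places given by
array `2`, and its dimensions. -/
structure Loaded (n b : ℕ) (M : ℕ → ℕ → Bool) (s : Store) : Prop where
  vertices : s.reg 2 = n
  boundary : s.reg 3 = b
  rows : s.reg 4 = n + b + 1
  entry : ∀ r < n + b + 1, ∀ c < n, s.arr 0 (s.arr 2 r + c) = if M r c then 1 else 0

/-- The program does not change the registers and arrays that `Loaded` refers to. -/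
def Prog.keepsInput (c : Prog) : Bool :=
  !(c.setsReg 2 || c.setsReg 3 || c.setsReg 4 || c.setsArr 0 || c.setsArr 2)

theorem Loaded.frame {n b : ℕ} {M : ℕ → ℕ → Bool} {s s' : Store} {c : Prog} (h : Loaded n b M s)
    (hf : Frame c s s') (hc : c.keepsInput = true) : Loaded n b M s' := by
  simp only [Prog.keepsInput, Bool.not_eq_true', Bool.or_eq_false_iff] at hc
  obtain ⟨⟨⟨⟨h2, h3⟩, h4⟩, h0⟩, h2'⟩ := hc
  refine ⟨?_, ?_, ?_, ?_⟩
  · rw [hf.reg 2 h2, h.vertices]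
  · rw [hf.reg 3 h3, h.boundary]
  · rw [hf.reg 4 h4, h.rows]
  · rw [hf.arr 0 h0, hf.arr 2 h2']
    exact h.entry

/-- The entry of the loaded matrix in row `r` and column `c`. -/
def Expr.entry (r c : Expr) : Expr := .read 0 (.add (.read 2 r) c)

theorem Loaded.eval_entry {n b : ℕ} {M : ℕ → ℕ → Bool} {s : Store} (h : Loaded n b M s)
    {r c : Expr} {i j : ℕ} (hr : r.eval s = i) (hc : c.eval s = j) (hi : i < n + b + 1)
    (hj : j < n) : (Expr.entry r c).eval s = if M i j then 1 else 0 := by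
  simp [Expr.entry, Expr.eval, hr, hc, h.entry i hi j hj]

/-- Without multiplication, the row starts `n + b + 2 + r * n` are tabulated in array 2 by repeated
addition. -/
def loadProg : Prog :=
  .seq (.while (.read 0 (.reg 2)) (.assign 2 (.add (.reg 2) (.const 1)))) <|
  .seq (.while (.read 0 (.add (.add (.reg 2) (.const 1)) (.reg 3)))
    (.assign 3 (.add (.reg 3) (.const 1)))) <|
  .seq (.assign 4 (.add (.add (.reg 2) (.reg 3)) (.const 1))) <|
  .seq (.assign 6 (.add (.reg 4) (.const 1))) <|
  .for 5 (.const 0) (.reg 4) <|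
    .seq (.write 2 (.reg 5) (.reg 6)) (.assign 6 (.add (.reg 6) (.reg 2)))

theorem runs_loadProg {n b : ℕ} {M : ℕ → ℕ → Bool} {w : List Bool} (hw : IsMatrixInput n b M w) :
    Runs loadProg (Store.init w) (n * 2 + 1 + (b * 2 + 1 + ((n + b + 1) * 4 + 2 + 1 + 1)))
      (Loaded n b M) := by
  have harr : ∀ i, (Store.init w).arr 0 i = if w[i]? = some true then 1 else 0 := by
    simp [Store.init]
  refine Runs.seq (Runs.while_count (T := 1) (fun i s => s.reg 2 = i) 0 n (Nat.zero_le _) ?_ ?_ ?_)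
    ?_
  · simp [Store.init]
  · rintro i s - hi hf rfl
    simp only [Expr.eval, hf.arr 0 rfl, harr]
    rcases hi.lt_or_eq with h | h
    · simp [hw.vertex _ h, h]
    · simp [h, hw.vertex_end]
  · rintro i s - hi hf rfl
    exact Runs.assign (by simp [Expr.eval])
  intro s₁ hf₁ h2
  refine Runs.seq (Runs.while_count (T := 1) (fun i s => s.reg 3 = i) 0 b (Nat.zero_le _) ?_ ?_ ?_)
    ?_
  · rw [hf₁.reg 3 rfl]
    simp [Store.init]
  · rintro i s - hi hf rfl
    simp only [Expr.eval, hf.arr 0 rfl, hf₁.arr 0 rfl, harr, hf.reg 2 rfl, h2]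
    rcases hi.lt_or_eq with h | h
    · simp [hw.boundary _ h, h]
    · simp [h, hw.boundary_end]
  · rintro i s - hi hf rfl
    exact Runs.assign (by simp [Expr.eval])
  intro s₂ hf₂ h3
  refine Runs.assign_seq (Runs.assign_seq ?_)
  refine (Runs.for_loop (T := 2) (fun i s => s.reg 6 = n + b + 2 + i * n ∧
    ∀ r < i, s.arr 2 r = n + b + 2 + r * n) 0 (n + b + 1) rfl (Nat.zero_le _) rfl ?_ ?_ ?_).mono
    le_rfl ?_
  · intro s hf
    simp [Expr.eval, hf.reg 4 rfl, hf₂.reg 2 rfl, h2, h3]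
  · simp [Expr.eval, hf₂.reg 2 rfl, h2, h3]
  · rintro i s - hi hf h5 ⟨h6, ha⟩
    refine Runs.write_seq (Runs.assign ⟨?_, ?_⟩)
    · have : s.reg 2 = n := by simp [hf.reg 2 rfl, hf₂.reg 2 rfl, h2]
      simp [Expr.eval, h6, this]
      ring
    · intro r hr
      simp only [Expr.eval, Store.setReg_arr, Store.setArr_arr, h5, h6, if_true,
        Function.update_apply]
      split_ifs with h
      · rw [h]
      · exact ha r (by omega)
  · rintro s hf ⟨-, ha⟩
    refine ⟨?_, ?_, ?_, ?_⟩
    · simp [hf.reg 2 rfl, hf₂.reg 2 rfl, h2]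
    · simp [hf.reg 3 rfl, h3]
    · simp [hf.reg 4 rfl, hf₂.reg 2 rfl, h2, h3, Expr.eval]
    · intro r hr c hc
      rw [ha r hr, hf.arr 0 rfl]
      simp only [Store.setReg_arr, hf₂.arr 0 rfl, hf₁.arr 0 rfl, harr]
      simp [hw.entry r hr c hc]

/-! ### Marking the cover and the boundary -/

/-- Rows `n, ..., n + b` hold the boundary positions and the cover, so array 3 ends up marking the
terminals. -/
def markProg : Prog :=
  .for 5 (.reg 2) (.reg 4) <| .for 6 (.const 0) (.reg 2) <|
    .ite (.entry (.reg 5) (.reg 6)) (.write 3 (.reg 6) (.const 1)) .skip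

theorem runs_markProg {n b : ℕ} {M : ℕ → ℕ → Bool} {s : Store} (hs : Loaded n b M s)
    (h3 : ∀ c < n, s.arr 3 c = 0) :
    Runs markProg s ((n + b + 1) * (n * 4 + 2 + 2) + 2)
      (fun s' => ∀ c < n, s'.arr 3 c ≠ 0 ↔ ∃ r, n ≤ r ∧ r < n + b + 1 ∧ M r c = true) := by
  refine Runs.for_loop (T := n * 4 + 2) (fun i s' => ∀ c < n, s'.arr 3 c ≠ 0 ↔
    ∃ r, n ≤ r ∧ r < i ∧ M r c = true) n (n + b + 1) ?_ (by omega) rfl ?_ ?_ ?_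
  · simp [Expr.eval, hs.vertices]
  · intro s' hf
    simp [Expr.eval, (hs.frame hf rfl).rows]
  · intro c hc
    simp only [Store.setReg_arr, h3 c hc]
    simp
    omega
  · intro i s₁ hi hi' hf h5 ih
    have hs₁ := hs.frame hf rfl
    refine (Runs.for_loop (T := 2) (fun j s' => ∀ c < n, s'.arr 3 c ≠ 0 ↔
      (∃ r, n ≤ r ∧ r < i ∧ M r c = true) ∨ (c < j ∧ M i c = true)) 0 n rfl (Nat.zero_le _) rfl
      ?_ ?_ ?_).mono le_rfl ?_
    · intro s' hf'
      simp [Expr.eval, (hs₁.frame hf' rfl).vertices]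
    · simpa using ih
    · intro j s₂ _ hj hf₂ h6 ih₂
      have he := (hs₁.frame hf₂ rfl).eval_entry (r := .reg 5) (c := .reg 6)
        ((hf₂.reg 5 rfl).trans h5) h6 hi' hj
      refine Runs.ite (fun h => Runs.write ?_) (fun h => Runs.skip ?_)
      · have hM : M i j = true := by simpa [he] using h
        intro c hc
        by_cases hcj : c = j
        · simp [Expr.eval, h6, hcj, hM]
        · have : c < j + 1 ↔ c < j := by omega
          simpa [Expr.eval, h6, hcj, Function.update_apply, this] using ih₂ c hc
      · have hM : M i j = false := by simpa [he] using h
        intro c hc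
        rw [Store.setReg_arr, ih₂ c hc]
        by_cases hcj : c = j
        · simp [hcj, hM]
        · have : c < j + 1 ↔ c < j := by omega
          simp [this]
    · intro s' _ h c hc
      rw [Store.setReg_arr, h c hc]
      constructor
      · rintro (⟨r, h₁, h₂, h₃⟩ | ⟨-, h₃⟩)
        exacts [⟨r, h₁, by omega, h₃⟩, ⟨i, hi, by omega, h₃⟩]
      · rintro ⟨r, h₁, h₂, h₃⟩
        rcases (Nat.lt_succ_iff.1 h₂).lt_or_eq with h | rfl
        exacts [.inl ⟨r, h₁, h, h₃⟩, .inr ⟨hc, h₃⟩]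

end RAM

namespace RAM

/-! ### The matching algorithm -/

/-- The invariant of an auction that matches the vertices `x < n` with `¬ T x` along the
entries of `M`: the vertex `u` is matched to `mt u - 1` unless `mt u = 0`, and its price is `lv u`. -/
structure Auction (n : ℕ) (M : ℕ → ℕ → Bool) (T : ℕ → Prop) (mt lv : ℕ → ℕ) : Prop where
  edge : ∀ u < n, mt u ≠ 0 → ∃ x < n, mt u = x + 1 ∧ ¬ T x ∧ M x u = true
  inj : ∀ u < n, ∀ u' < n, mt u ≠ 0 → mt u = mt u' → u = u'
  matched : ∀ u < n, lv u ≠ 0 → mt u ≠ 0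
  -- Approximate complementary slackness: a price value that is skipped cannot be crossed by an edge
  -- from a partner of a vertex above it.
  slack : ∀ u < n, ∀ x, mt u = x + 1 → ∀ u' < n, M x u' = true → lv u ≤ lv u' + 1

/-- The vertex `x` is matched, or all its neighbours have reached the maximum price. -/
def Settled (n : ℕ) (M : ℕ → ℕ → Bool) (mt lv : ℕ → ℕ) (x : ℕ) : Prop :=
  (∃ u < n, mt u = x + 1) ∨ ∀ u < n, M x u = true → n + 1 ≤ lv u

/-- The invariant of the auction while the vertex `X - 1` is unmatched (none if `X = 0`) and the
other vertices below `v` are settled. -/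
structure AuctionStep (n : ℕ) (M : ℕ → ℕ → Bool) (T : ℕ → Prop) (v : ℕ) (mt lv : ℕ → ℕ) (X : ℕ) :
    Prop where
  auction : Auction n M T mt lv
  active : X ≠ 0 → ∃ x < n, X = x + 1 ∧ ¬ T x ∧ ∀ u < n, mt u ≠ X
  active_le : X ≤ v
  matched_le : ∀ u < n, mt u ≤ v
  settled : ∀ z < v, ¬ T z → z + 1 ≠ X → Settled n M mt lv z

/-- The total amount by which prices can still rise. -/
def priceGap (n : ℕ) (lv : ℕ → ℕ) : ℕ := ∑ u ∈ Finset.range n, (n + 1 - lv u)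

theorem priceGap_le (n : ℕ) (lv : ℕ → ℕ) : priceGap n lv ≤ n * (n + 1) := by
  refine (Finset.sum_le_card_nsmul _ _ (n + 1) fun u _ => Nat.sub_le _ _).trans ?_
  simp

/-! ### Discarding and bidding preserve the invariant. -/

section

variable {n : ℕ} {M : ℕ → ℕ → Bool} {T : ℕ → Prop} {mt lv : ℕ → ℕ} {v x : ℕ}

theorem priceGap_update_lt {u : ℕ} (hu : u < n) (hlt : lv u < n + 1) :
    priceGap n (Function.update lv u (lv u + 1)) < priceGap n lv := by
  refine Finset.sum_lt_sum (fun i _ => ?_) ⟨u, Finset.mem_range.2 hu, ?_⟩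
  · by_cases h : i = u
    · subst h
      rw [Function.update_self]
      omega
    · rw [Function.update_of_ne h]
  · rw [Function.update_self]
    omega

theorem AuctionStep.discard (h : AuctionStep n M T v mt lv (x + 1))
    (hx : ∀ u < n, M x u = true → n + 1 ≤ lv u) : AuctionStep n M T v mt lv 0 where
  auction := h.auction
  active h0 := absurd rfl h0
  active_le := Nat.zero_le _
  matched_le := h.matched_le
  settled z hz hT _ := by
    by_cases hzx : z = x
    · exact .inr (hzx ▸ hx)
    · exact h.settled z hz hT (by omega)

/-- Slack holds for the new pair because `u` was a cheapest neighbour of `x` before its price rose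
by one, and for the old pairs because prices never fall. Only the former partner of `u` can become
unsettled, and it is the new active vertex. -/
theorem AuctionStep.assign (h : AuctionStep n M T v mt lv (x + 1)) {u : ℕ} (hu : u < n)
    (hM : M x u = true) (hmin : ∀ u' < n, M x u' = true → lv u ≤ lv u') :
    AuctionStep n M T v (Function.update mt u (x + 1)) (Function.update lv u (lv u + 1)) (mt u) := by
  obtain ⟨x', hxn, hxx, hxT, hfree⟩ := h.active (by omega)
  obtain rfl : x = x' := by omega
  have hle : ∀ i, lv i ≤ Function.update lv u (lv u + 1) i := by
    intro i
    by_cases hi : i = u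
    · subst hi; simp
    · simp [hi]
  refine ⟨⟨?_, ?_, ?_, ?_⟩, ?_, h.matched_le u hu, ?_, ?_⟩
  · intro i hi hne
    by_cases hiu : i = u
    · subst hiu
      exact ⟨x, hxn, by simp, hxT, hM⟩
    · rw [Function.update_of_ne hiu] at hne ⊢
      exact h.auction.edge i hi hne
  · intro i hi i' hi' hne heq
    by_cases hiu : i = u <;> by_cases hiu' : i' = u
    · rw [hiu, hiu']
    · subst hiu
      rw [Function.update_self, Function.update_of_ne hiu'] at heq
      exact absurd heq.symm (hfree i' hi')
    · subst hiu'
      rw [Function.update_self, Function.update_of_ne hiu] at heq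
      exact absurd heq (hfree i hi)
    · rw [Function.update_of_ne hiu] at hne heq
      rw [Function.update_of_ne hiu'] at heq
      exact h.auction.inj i hi i' hi' hne heq
  · intro i hi hne
    by_cases hiu : i = u
    · subst hiu; simp
    · rw [Function.update_of_ne hiu] at hne ⊢
      exact h.auction.matched i hi hne
  · intro i hi y hy u' hu' hM'
    refine le_trans ?_ (Nat.succ_le_succ (hle u'))
    by_cases hiu : i = u
    · subst hiu
      rw [Function.update_self] at hy ⊢
      obtain rfl : x = y := by omega
      exact Nat.succ_le_succ (hmin u' hu' hM')
    · rw [Function.update_of_ne hiu] at hy ⊢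
      exact h.auction.slack i hi y hy u' hu' hM'
  · intro hne
    obtain ⟨y, hy, hyx, hyT, -⟩ := h.auction.edge u hu hne
    refine ⟨y, hy, hyx, hyT, fun i hi heq => ?_⟩
    by_cases hiu : i = u
    · subst hiu
      rw [Function.update_self] at heq
      exact hfree i hi heq.symm
    · rw [Function.update_of_ne hiu] at heq
      exact hiu (h.auction.inj u hu i hi hne heq.symm).symm
  · intro i hi
    by_cases hiu : i = u
    · subst hiu
      rw [Function.update_self]
      exact h.active_le
    · rw [Function.update_of_ne hiu]
      exact h.matched_le i hi
  · intro z hz hT hzu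
    by_cases hzx : z = x
    · exact .inl ⟨u, hu, by simp [hzx]⟩
    · rcases h.settled z hz hT (by omega) with ⟨i, hi, hiz⟩ | hall
      · refine .inl ⟨i, hi, ?_⟩
        rw [Function.update_of_ne, hiz]
        rintro rfl
        exact hzu hiz.symm
      · exact .inr fun i hi hMi => (hall i hi hMi).trans (hle i)

end

/-! ### The auction as a program. -/

/-- Find a neighbour of the vertex `x`, where `x + 1` is in register `6`, of minimum price. -/
def chooseProg : Prog :=
  .seq (.assign 7 (.add (.reg 2) (.const 1))) <|
  .for 8 (.const 0) (.reg 2) <|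
    .ite (.entry (.sub (.reg 6) (.const 1)) (.reg 8))
      (.ite (.lt (.read 5 (.reg 8)) (.reg 7))
        (.seq (.assign 7 (.read 5 (.reg 8))) (.assign 9 (.reg 8))) .skip)
      .skip

/-- The running minimum in register 7 starts at the cap `n + 1`; if it stays there, no neighbour is
affordable and register 9 is meaningless. -/
theorem runs_chooseProg {n b x : ℕ} {M : ℕ → ℕ → Bool} {s : Store} (hs : Loaded n b M s)
    (hx : x < n) (h6 : s.reg 6 = x + 1) :
    Runs chooseProg s (n * 6 + 2 + 1) (fun s' =>
      (s'.reg 7 < n + 1 → s'.reg 9 < n ∧ M x (s'.reg 9) = true ∧ s.arr 5 (s'.reg 9) = s'.reg 7) ∧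
      s'.reg 7 ≤ n + 1 ∧ ∀ u < n, M x u = true → s'.reg 7 ≤ s.arr 5 u) := by
  refine Runs.assign_seq ?_
  refine (Runs.for_loop (T := 4) (fun i s' =>
      (s'.reg 7 < n + 1 → s'.reg 9 < n ∧ M x (s'.reg 9) = true ∧ s.arr 5 (s'.reg 9) = s'.reg 7) ∧
      s'.reg 7 ≤ n + 1 ∧ ∀ u < i, M x u = true → s'.reg 7 ≤ s.arr 5 u) 0 n rfl (Nat.zero_le _) rfl
      ?_ ?_ ?_)
  · intro s' hf
    simp [Expr.eval, hf.reg 2 rfl, hs.vertices]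
  · simp [Expr.eval, hs.vertices]
  · rintro i s' - hi hf h8 ⟨h₁, h₂, h₃⟩
    have hs' : Loaded n b M s' := (hs.frame (Exec.assign s 7 _).frame rfl).frame hf rfl
    have he := hs'.eval_entry (r := .sub (.reg 6) (.const 1)) (c := .reg 8) (i := x) (j := i)
      (by simp [Expr.eval, hf.reg 6 rfl, h6]) h8 (by omega) hi
    have h5 : s'.arr 5 = s.arr 5 := hf.arr 5 rfl
    refine Runs.ite (T := 3) (fun h => Runs.ite (T := 2) (fun hlt => Runs.assign_seq (Runs.assign ?_))
      (fun hlt => (Runs.skip ?_).mono (by omega) (fun _ _ h => h)))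
      (fun h => (Runs.skip ?_).mono (by omega) (fun _ _ h => h))
    · have hM : M x i = true := by simpa [he] using h
      have hlt : s.arr 5 i < s'.reg 7 := by simpa [Expr.eval, h8, h5] using hlt
      simp only [Expr.eval, h8, h5, Store.setReg_reg]
      simp only [reduceIte, Nat.reduceEqDiff]
      refine ⟨fun _ => ⟨hi, hM, trivial⟩, by omega, fun u hu hMu => ?_⟩
      rcases (Nat.lt_succ_iff.1 hu).lt_or_eq with h | rfl
      · exact hlt.le.trans (h₃ u h hMu)
      · exact le_rfl
    · have hlt : s'.reg 7 ≤ s.arr 5 i := by simpa [Expr.eval, h8, h5] using hlt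
      simp only [Store.setReg_reg, Nat.reduceEqDiff, reduceIte]
      refine ⟨h₁, h₂, fun u hu hMu => ?_⟩
      rcases (Nat.lt_succ_iff.1 hu).lt_or_eq with h | rfl
      · exact h₃ u h hMu
      · exact hlt
    · have hM : M x i = false := by simpa [he] using h
      simp only [Store.setReg_reg, Nat.reduceEqDiff, reduceIte]
      refine ⟨h₁, h₂, fun u hu hMu => ?_⟩
      rcases (Nat.lt_succ_iff.1 hu).lt_or_eq with h | rfl
      · exact h₃ u h hMu
      · simp [hM] at hMu

/-- Assign the active vertex to the neighbour found by `chooseProg`, whose former partner becomes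
active, or discard it. -/
def bidProg : Prog :=
  .seq chooseProg <|
  .ite (.lt (.reg 7) (.add (.reg 2) (.const 1)))
    (.seq (.assign 10 (.read 4 (.reg 9))) <|
     .seq (.write 4 (.reg 9) (.reg 6)) <|
     .seq (.write 5 (.reg 9) (.add (.reg 7) (.const 1))) <|
     .assign 6 (.reg 10))
    (.assign 6 (.const 0))

/-- A bid lowers the price gap; a discard leaves it alone but ends the activity, which the extra
summand counts. -/
theorem runs_bidProg {n b v : ℕ} {M : ℕ → ℕ → Bool} {T : ℕ → Prop} {s : Store}
    (hs : Loaded n b M s) (h : AuctionStep n M T v (s.arr 4) (s.arr 5) (s.reg 6))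
    (h6 : s.reg 6 ≠ 0) :
    Runs bidProg s (n * 6 + 8) (fun s' => AuctionStep n M T v (s'.arr 4) (s'.arr 5) (s'.reg 6) ∧
      priceGap n (s'.arr 5) + (if s'.reg 6 = 0 then 0 else 1) <
        priceGap n (s.arr 5) + (if s.reg 6 = 0 then 0 else 1)) := by
  obtain ⟨x, hx, hX, -, -⟩ := h.active h6
  refine (Runs.seq (T₂ := 5) (runs_chooseProg hs hx hX) ?_).mono (by omega) (fun _ _ h => h)
  rintro s₁ hf ⟨h₁, h₂, h₃⟩
  have hs₁ := hs.frame hf rfl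
  have h5 : s₁.arr 5 = s.arr 5 := hf.arr 5 rfl
  have h4 : s₁.arr 4 = s.arr 4 := hf.arr 4 rfl
  have h6' : s₁.reg 6 = x + 1 := (hf.reg 6 rfl).trans hX
  rw [hX] at h ⊢
  refine Runs.ite (T := 4) (fun hlt => ?_) (fun hlt => ?_)
  · have hlt : s₁.reg 7 < n + 1 := by simpa [Expr.eval, hs₁.vertices] using hlt
    obtain ⟨hu, hM, hlv⟩ := h₁ hlt
    refine Runs.assign_seq (Runs.write_seq (Runs.write_seq (Runs.assign ?_)))
    simp only [Expr.eval, Store.setReg_reg, Store.setReg_arr, Store.setArr_arr, Store.setArr_reg,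
      Nat.reduceEqDiff, reduceIte, h4, h5, h6', ← hlv]
    refine ⟨h.assign hu hM (fun u' hu' hM' => hlv ▸ h₃ u' hu' hM'), ?_⟩
    have := priceGap_update_lt (lv := s.arr 5) hu (by omega)
    split_ifs <;> omega
  · have hle : n + 1 ≤ s₁.reg 7 := by simpa [Expr.eval, hs₁.vertices] using hlt
    refine (Runs.assign ?_).mono (T₁ := 1) (by omega) (fun _ _ h => h)
    simp only [Expr.eval, Store.setReg_reg, Store.setReg_arr, reduceIte, h4, h5]
    refine ⟨h.discard fun u hu hM => hle.trans (h₃ u hu hM), ?_⟩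
    simp

def matchProg : Prog :=
  .for 5 (.const 0) (.reg 2) <|
    .ite (.read 3 (.reg 5)) .skip <|
      .seq (.assign 6 (.add (.reg 5) (.const 1))) (.while (.reg 6) bidProg)

theorem runs_matchProg {n b : ℕ} {M : ℕ → ℕ → Bool} {T : ℕ → Prop} {s : Store}
    (hs : Loaded n b M s) (hT : ∀ c < n, s.arr 3 c ≠ 0 ↔ T c) (h4 : ∀ u < n, s.arr 4 u = 0)
    (h5 : ∀ u < n, s.arr 5 u = 0) :
    Runs matchProg s (n * (((n * (n + 1) + 1) * (n * 6 + 9) + 3) + 2) + 2) (fun s' =>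
      Auction n M T (s'.arr 4) (s'.arr 5) ∧
        ∀ z < n, ¬ T z → Settled n M (s'.arr 4) (s'.arr 5) z) := by
  refine (Runs.for_loop (T := (n * (n + 1) + 1) * (n * 6 + 9) + 3)
    (fun i s' => AuctionStep n M T i (s'.arr 4) (s'.arr 5) 0) 0 n rfl
    (Nat.zero_le _) rfl ?_ ?_ ?_).mono le_rfl
    (fun s' _ h => ⟨h.auction, fun z hz hTz => h.settled z hz hTz (by omega)⟩)
  · intro s' hf
    simp [Expr.eval, (hs.frame hf rfl).vertices]
  · refine ⟨⟨?_, ?_, ?_, ?_⟩, ?_, ?_, ?_, ?_⟩ <;>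
      simp +contextual [h4, h5]
  · intro i s₁ _ hi hf hr5 h
    have hs₁ := hs.frame hf rfl
    have hTi : s₁.arr 3 i ≠ 0 ↔ T i := by rw [hf.arr 3 rfl, hT i hi]
    refine Runs.ite (fun hne => ?_) (fun heq => ?_)
    · refine (Runs.skip ?_).mono (by omega) (fun _ _ h => h)
      have : T i := hTi.1 (by simpa [Expr.eval, hr5] using hne)
      refine ⟨h.auction, fun h0 => absurd rfl h0, Nat.zero_le _,
        fun u hu => Nat.le_succ_of_le (h.matched_le u hu), fun z hz hTz hz0 => h.settled z ?_ hTz hz0⟩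
      have : z ≠ i := by rintro rfl; exact hTz this
      omega
    · have hTi : ¬ T i := by rw [← hTi, not_not]; simpa [Expr.eval, hr5] using heq
      refine Runs.assign_seq ?_
      simp only [Expr.eval, hr5]
      -- So far all partners are below `i`, so vertex `i` enters unmatched.
      have hfree : ∀ u < n, s₁.arr 4 u ≠ i + 1 := fun u hu heq => by
        have := h.matched_le u hu
        omega
      refine (Runs.while_measure (T := n * 6 + 8)
        (fun s' => AuctionStep n M T (i + 1) (s'.arr 4) (s'.arr 5) (s'.reg 6))
        (fun s' => priceGap n (s'.arr 5) + (if s'.reg 6 = 0 then 0 else 1)) ?_ ?_).mono ?_ ?_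
      · simp only [Store.setReg_reg, Store.setReg_arr, reduceIte]
        refine ⟨h.auction, fun _ => ⟨i, hi, rfl, hTi, hfree⟩, le_rfl,
          fun u hu => Nat.le_succ_of_le (h.matched_le u hu), fun z hz hTz hzi => ?_⟩
        exact h.settled z (by omega) hTz (by omega)
      · intro s' hf' h hne
        exact runs_bidProg ((hs₁.frame (Exec.assign s₁ 6 (.const (i + 1))).frame rfl).frame hf' rfl)
          h hne
      · have := priceGap_le n (s₁.arr 5)
        simp only [Store.setReg_reg, Store.setReg_arr, reduceIte]
        gcongr ?_ * _ + ?_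
        · simpa
        · omega
      · rintro s' - ⟨h, h0⟩
        have h0 : s'.reg 6 = 0 := h0
        simpa [h0] using h

end RAM

namespace RAM

/-! ### Writing the output -/

/-- Array 3 becomes a filter for rows and columns alike: partners join the terminals, and all
boundary and cover rows are kept. -/
def keepProg : Prog :=
  .seq (.for 5 (.const 0) (.reg 2) <|
    .ite (.read 4 (.reg 5)) (.write 3 (.sub (.read 4 (.reg 5)) (.const 1)) (.const 1)) .skip) <|
  .for 5 (.reg 2) (.reg 4) (.write 3 (.reg 5) (.const 1))

theorem runs_keepProg {n b : ℕ} {M : ℕ → ℕ → Bool} {T : ℕ → Prop} {s : Store}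
    (hs : Loaded n b M s) (hT : ∀ c < n, s.arr 3 c ≠ 0 ↔ T c) :
    Runs keepProg s (n * 4 + 2 + ((n + b + 1) * 3 + 2)) (fun s' =>
      (∀ c < n, s'.arr 3 c ≠ 0 ↔ T c ∨ ∃ u < n, s.arr 4 u = c + 1) ∧
        ∀ r, n ≤ r → r < n + b + 1 → s'.arr 3 r ≠ 0) := by
  refine Runs.seq (Runs.for_loop (T := 2)
    (fun i s' => ∀ c < n, s'.arr 3 c ≠ 0 ↔ T c ∨ ∃ u < i, s.arr 4 u = c + 1) 0 n rfl
    (Nat.zero_le _) rfl ?_ ?_ ?_) ?_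
  · intro s' hf
    simp [Expr.eval, (hs.frame hf rfl).vertices]
  · simpa using hT
  · intro i s₁ _ hi hf h5 ih
    have h4 : s₁.arr 4 = s.arr 4 := hf.arr 4 rfl
    have hstep : ∀ c, (∃ u < i + 1, s.arr 4 u = c + 1) ↔
        (∃ u < i, s.arr 4 u = c + 1) ∨ s.arr 4 i = c + 1 := by
      intro c
      constructor
      · rintro ⟨u, hu, h⟩
        rcases (Nat.lt_succ_iff.1 hu).lt_or_eq with h' | rfl
        exacts [.inl ⟨u, h', h⟩, .inr h]
      · rintro (⟨u, hu, h⟩ | h)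
        exacts [⟨u, by omega, h⟩, ⟨i, by omega, h⟩]
    refine Runs.ite (fun h => Runs.write ?_) (fun h => Runs.skip ?_)
    · have h : s.arr 4 i ≠ 0 := by simpa [Expr.eval, h5, h4] using h
      intro c hc
      rw [hstep, ← or_assoc]
      simp only [Expr.eval, h5, h4, Store.setReg_arr, Store.setArr_arr, reduceIte,
        Function.update_apply]
      by_cases hci : c = s.arr 4 i - 1
      · have : s.arr 4 i = c + 1 := by omega
        simp [this]
      · have : s.arr 4 i ≠ c + 1 := by omega
        simpa [hci, this] using ih c hc
    · have h : s.arr 4 i = 0 := by simpa [Expr.eval, h5, h4] using h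
      intro c hc
      rw [hstep, Store.setReg_arr, ih c hc, h]
      simp
  · intro s₁ hf₁ h₁
    have hs₁ := hs.frame hf₁ rfl
    refine (Runs.for_loop (T := 1)
      (fun i s' => (∀ c < n, s'.arr 3 c ≠ 0 ↔ T c ∨ ∃ u < n, s.arr 4 u = c + 1) ∧
        ∀ r, n ≤ r → r < i → s'.arr 3 r ≠ 0) n (n + b + 1) ?_ (by omega) rfl ?_ ?_ ?_)
    · simp [Expr.eval, hs₁.vertices]
    · intro s' hf
      simp [Expr.eval, (hs₁.frame hf rfl).rows]
    · exact ⟨h₁, fun r hr hr' => absurd hr' (by omega)⟩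
    · rintro i s₂ hi hi' hf h5 ⟨h₂, h₃⟩
      refine Runs.write ⟨fun c hc => ?_, fun r hr hr' => ?_⟩
      · have : c ≠ i := by omega
        simpa [Expr.eval, h5, this] using h₂ c hc
      · by_cases hri : r = i
        · simp [Expr.eval, h5, hri]
        · simpa [Expr.eval, h5, hri] using h₃ r hr (by omega)

/-- Append a bit to the output. -/
def Prog.emit (e : Expr) : Prog :=
  .seq (.write 1 (.reg 1) e) (.assign 1 (.add (.reg 1) (.const 1)))

theorem runs_emit {s : Store} {l : List Bool} {e : Expr} {β : Bool} (h : s.HasOutput l)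
    (he : e.eval s = if β then 1 else 0) :
    Runs (.emit e) s 2 (fun s' => s'.HasOutput (l ++ [β])) := by
  refine Runs.write_seq (Runs.assign ⟨?_, fun i hi => ?_⟩)
  · simp [Expr.eval, h.1]
  · simp only [Store.setReg_arr, Store.setArr_arr, reduceIte, Expr.eval, h.1, he,
      Function.update_apply]
    by_cases hil : i = l.length
    · subst hil
      simp
    · have : i < l.length := by
        simp at hi
        omega
      simp [hil, List.getElem_append_left this, h.2 i this]

theorem Store.HasOutput.frame {s s' : Store} {l : List Bool} {c : Prog} (h : s.HasOutput l)
    (hf : Frame c s s') (hr : c.setsReg 1 = false) (ha : c.setsArr 1 = false) : s'.HasOutput l := by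
  unfold Store.HasOutput at *
  rwa [hf.reg 1 hr, hf.arr 1 ha]

theorem Store.HasOutput.setReg {s : Store} {l : List Bool} {x v : ℕ} (h : s.HasOutput l)
    (hx : x ≠ 1) : (s.setReg x v).HasOutput l := by
  unfold Store.HasOutput at *
  simpa [hx.symm] using h

theorem filter_range_succ (K : ℕ → Bool) (i : ℕ) :
    (List.range (i + 1)).filter K = (List.range i).filter K ++ if K i then [i] else [] := by
  rw [List.range_succ, List.filter_append]
  by_cases h : K i <;> simp [h]

def headerProg : Prog :=
  .seq (.for 5 (.const 0) (.reg 2) <| .ite (.read 3 (.reg 5)) (.emit (.const 1)) .skip) <|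
  .seq (.emit (.const 0)) <|
  .seq (.for 5 (.const 0) (.reg 3) <| .emit (.const 1)) <|
  .emit (.const 0)

theorem runs_headerProg {n b : ℕ} {M : ℕ → ℕ → Bool} {K : ℕ → Bool} {s : Store}
    (hs : Loaded n b M s) (hK : ∀ c < n, s.arr 3 c ≠ 0 ↔ K c = true) (h0 : s.reg 1 = 0) :
    Runs headerProg s (n * 5 + 2 + (2 + (b * 4 + 2 + 2))) (fun s' => s'.HasOutput
      (List.replicate ((List.range n).filter K).length true ++ [false] ++
        List.replicate b true ++ [false])) := by
  refine Runs.seq (Runs.for_loop (T := 3)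
    (fun i s' => s'.HasOutput (List.replicate ((List.range i).filter K).length true)) 0 n rfl
    (Nat.zero_le _) rfl ?_ ?_ ?_) ?_
  · intro s' hf
    simp [Expr.eval, (hs.frame hf rfl).vertices]
  · simp [Store.HasOutput, h0]
  · intro i s₁ _ hi hf h5 h
    have hKi : s₁.arr 3 i ≠ 0 ↔ K i = true := by rw [hf.arr 3 rfl, hK i hi]
    rw [filter_range_succ]
    refine Runs.ite (fun hne => ?_) (fun heq => ?_)
    · have : K i = true := hKi.1 (by simpa [Expr.eval, h5] using hne)
      refine (runs_emit (β := true) h rfl).mono le_rfl (fun s' _ h' => ?_)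
      simpa [this, List.replicate_add] using h'.setReg (x := 5) (by omega)
    · have : ¬ K i = true := by rw [← hKi, not_not]; simpa [Expr.eval, h5] using heq
      refine (Runs.skip ?_).mono (by omega) (fun _ _ h => h)
      simpa [this] using h.setReg (x := 5) (by omega)
  intro s₁ hf₁ h₁
  refine Runs.seq (runs_emit (β := false) h₁ rfl) fun s₂ hf₂ h₂ => ?_
  have hs₂ := (hs.frame hf₁ rfl).frame hf₂ rfl
  refine Runs.seq (Runs.for_loop (T := 2)
    (fun i s' => s'.HasOutput (List.replicate ((List.range n).filter K).length true ++ [false] ++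
      List.replicate i true)) 0 b rfl (Nat.zero_le _) rfl ?_ ?_ ?_) ?_
  · intro s' hf
    simp [Expr.eval, (hs₂.frame hf rfl).boundary]
  · simpa using h₂.setReg (x := 5) (by omega)
  · intro i s₃ _ hi hf h5 h
    refine (runs_emit (β := true) h rfl).mono le_rfl (fun s' _ h' => ?_)
    simpa [List.replicate_add] using h'.setReg (x := 5) (by omega)
  · intro s₃ hf₃ h₃
    exact runs_emit (β := false) h₃ rfl

/-- Kept indices stay in increasing order, so deleting rows and columns yields exactly the matrix of
the induced instance. -/
def matrixProg : Prog :=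
  .for 5 (.const 0) (.reg 4) <| .ite (.read 3 (.reg 5))
    (.for 6 (.const 0) (.reg 2) <|
      .ite (.read 3 (.reg 6)) (.emit (.entry (.reg 5) (.reg 6))) .skip)
    .skip

theorem runs_matrixProg {n b : ℕ} {M : ℕ → ℕ → Bool} {K : ℕ → Bool} {s : Store} {l : List Bool}
    (hs : Loaded n b M s) (hK : ∀ r < n + b + 1, s.arr 3 r ≠ 0 ↔ K r = true)
    (hl : s.HasOutput l) :
    Runs matrixProg s ((n + b + 1) * ((n * 5 + 3) + 2) + 2) (fun s' => s'.HasOutput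
      (l ++ ((List.range (n + b + 1)).filter K).flatMap
        fun r => ((List.range n).filter K).map (M r))) := by
  refine Runs.for_loop (T := n * 5 + 3)
    (fun i s' => s'.HasOutput (l ++ ((List.range i).filter K).flatMap
        fun r => ((List.range n).filter K).map (M r))) 0 (n + b + 1) rfl
    (Nat.zero_le _) rfl ?_ ?_ ?_
  · intro s' hf
    simp [Expr.eval, (hs.frame hf rfl).rows]
  · simpa using hl.setReg (x := 5) (by omega)
  · intro i s₁ _ hi hf h5 h
    have hs₁ := hs.frame hf rfl
    have hKi : s₁.arr 3 i ≠ 0 ↔ K i = true := by rw [hf.arr 3 rfl, hK i hi]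
    rw [filter_range_succ]
    refine Runs.ite (T := n * 5 + 2) (fun hne => ?_) (fun heq => ?_)
    · have hKi : K i = true := hKi.1 (by simpa [Expr.eval, h5] using hne)
      rw [if_pos hKi, List.flatMap_append, ← List.append_assoc, List.flatMap_singleton]
      generalize l ++ _ = l' at h
      refine (Runs.for_loop (T := 3)
        (fun j s' => s'.HasOutput (l' ++ ((List.range j).filter K).map (M i))) 0 n rfl
        (Nat.zero_le _) rfl ?_ ?_ ?_).mono le_rfl (fun s' _ h' => h'.setReg (by omega))
      · intro s' hf
        simp [Expr.eval, (hs₁.frame hf rfl).vertices]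
      · simpa using h.setReg (x := 6) (by omega)
      · intro j s₂ _ hj hf₂ h6 h'
        have hKj : s₂.arr 3 j ≠ 0 ↔ K j = true := by
          rw [hf₂.arr 3 rfl, hf.arr 3 rfl, hK j (by omega)]
        rw [filter_range_succ]
        refine Runs.ite (T := 2) (fun hne => ?_) (fun heq => ?_)
        · have hKj : K j = true := hKj.1 (by simpa [Expr.eval, h6] using hne)
          have he := (hs₁.frame hf₂ rfl).eval_entry (r := .reg 5) (c := .reg 6)
            ((hf₂.reg 5 rfl).trans h5) h6 hi hj
          refine (runs_emit h' he).mono le_rfl (fun s' _ h'' => ?_)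
          simpa [hKj] using h''.setReg (x := 6) (by omega)
        · have : ¬ K j = true := by rw [← hKj, not_not]; simpa [Expr.eval, h6] using heq
          refine (Runs.skip ?_).mono (by omega) (fun _ _ h => h)
          simpa [this] using h'.setReg (x := 6) (by omega)
    · have : ¬ K i = true := by rw [← hKi, not_not]; simpa [Expr.eval, h5] using heq
      refine (Runs.skip ?_).mono (by omega) (fun _ _ h => h)
      simpa [this] using h.setReg (x := 5) (by omega)

/-! ### The kernelization program -/

def kernelProg : Prog :=
  .seq loadProg <| .seq markProg <| .seq matchProg <| .seq keepProg <| .seq headerProg <|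
    .seq matrixProg (.emit (.const 0))

/-- Bound for the running time of `kernelProg` in terms of the number of vertices and the size of
the boundary. -/
def kernelTime (n b : ℕ) : ℕ :=
  n * 2 + 1 + (b * 2 + 1 + ((n + b + 1) * 4 + 2 + 1 + 1)) +
  ((n + b + 1) * (n * 4 + 2 + 2) + 2 +
  (n * (((n * (n + 1) + 1) * (n * 6 + 9) + 3) + 2) + 2 +
  (n * 4 + 2 + ((n + b + 1) * 3 + 2) +
  (n * 5 + 2 + (2 + (b * 4 + 2 + 2)) + ((n + b + 1) * ((n * 5 + 3) + 2) + 2 + 2)))))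

theorem runs_kernelProg {n b : ℕ} {M : ℕ → ℕ → Bool} {w : List Bool} (hw : IsMatrixInput n b M w)
    {T : ℕ → Prop} (hT : ∀ c < n, T c ↔ ∃ r, n ≤ r ∧ r < n + b + 1 ∧ M r c = true) :
    ∃ (K : ℕ → Bool) (mt lv : ℕ → ℕ), Auction n M T mt lv ∧
      (∀ z < n, ¬ T z → Settled n M mt lv z) ∧
      (∀ c < n, K c = true ↔ T c ∨ ∃ u < n, mt u = c + 1) ∧
      (∀ r, n ≤ r → r < n + b + 1 → K r = true) ∧
      Runs kernelProg (Store.init w) (kernelTime n b) (fun s => s.HasOutput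
        (List.replicate ((List.range n).filter K).length true ++ [false] ++
          List.replicate b true ++ [false] ++
          (((List.range (n + b + 1)).filter K).flatMap
            fun r => ((List.range n).filter K).map (M r)) ++ [false])) := by
  -- The witnesses are read off from memories reached during the run, so they are first quantified
  -- inside the postcondition.
  suffices h : Runs kernelProg (Store.init w) (kernelTime n b) (fun s =>
      ∃ (K : ℕ → Bool) (mt lv : ℕ → ℕ), Auction n M T mt lv ∧
      (∀ z < n, ¬ T z → Settled n M mt lv z) ∧
      (∀ c < n, K c = true ↔ T c ∨ ∃ u < n, mt u = c + 1) ∧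
      (∀ r, n ≤ r → r < n + b + 1 → K r = true) ∧ s.HasOutput
        (List.replicate ((List.range n).filter K).length true ++ [false] ++
          List.replicate b true ++ [false] ++
          (((List.range (n + b + 1)).filter K).flatMap
            fun r => ((List.range n).filter K).map (M r)) ++ [false])) by
    obtain ⟨t, s, he, ht, K, mt, lv, h₁, h₂, h₃, h₄, h₅⟩ := h
    exact ⟨K, mt, lv, h₁, h₂, h₃, h₄, t, s, he, ht, h₅⟩
  have hinit : ∀ a, a ≠ 0 → ∀ i, (Store.init w).arr a i = 0 := by
    intro a ha i
    simp [Store.init, ha]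
  refine Runs.seq (runs_loadProg hw) fun s₁ hf₁ hs₁ => ?_
  refine Runs.seq (runs_markProg hs₁ fun c _ => ?_) fun s₂ hf₂ hm => ?_
  · rw [hf₁.arr 3 rfl, hinit 3 (by omega)]
  have hs₂ := hs₁.frame hf₂ rfl
  replace hm : ∀ c < n, s₂.arr 3 c ≠ 0 ↔ T c := fun c hc => (hm c hc).trans (hT c hc).symm
  refine Runs.seq (runs_matchProg hs₂ hm (fun u _ => ?_) (fun u _ => ?_))
    fun s₃ hf₃ ⟨hA, hset⟩ => ?_
  · rw [hf₂.arr 4 rfl, hf₁.arr 4 rfl, hinit 4 (by omega)]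
  · rw [hf₂.arr 5 rfl, hf₁.arr 5 rfl, hinit 5 (by omega)]
  have hs₃ := hs₂.frame hf₃ rfl
  rw [← hf₃.arr 3 rfl] at hm
  refine Runs.seq (runs_keepProg hs₃ hm) fun s₄ hf₄ ⟨hk, hk'⟩ => ?_
  have hs₄ := hs₃.frame hf₄ rfl
  have h1 : s₄.reg 1 = 0 := by
    rw [hf₄.reg 1 rfl, hf₃.reg 1 rfl, hf₂.reg 1 rfl, hf₁.reg 1 rfl]
    simp [Store.init]
  let K : ℕ → Bool := fun r => decide (s₄.arr 3 r ≠ 0)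
  have hK : ∀ r, s₄.arr 3 r ≠ 0 ↔ K r = true := fun r => by simp [K]
  refine Runs.seq (runs_headerProg hs₄ (fun c _ => hK c) h1) fun s₅ hf₅ h₅ => ?_
  refine Runs.seq (runs_matrixProg (K := K) (hs₄.frame hf₅ rfl) (fun r _ => ?_) h₅)
    fun s₆ hf₆ h₆ => ?_
  · rw [hf₅.arr 3 rfl, hK]
  refine (runs_emit (β := false) h₆ rfl).mono le_rfl fun s₇ _ h₇ => ?_
  refine ⟨K, s₃.arr 4, s₃.arr 5, hA, hset, fun c hc => ?_, fun r hr hr' => ?_, h₇⟩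
  · rw [← hK, hk c hc]
  · rw [← hK]
    exact hk' r hr hr'

theorem kernelTime_mono {n b N : ℕ} (hn : n ≤ N) (hb : b ≤ N) :
    kernelTime n b ≤ kernelTime N N := by
  unfold kernelTime
  gcongr

theorem exists_polynomial_kernelTime :
    ∃ p : Polynomial ℕ, ∀ N, p.eval N = kernelTime N N := by
  let k : Polynomial ℕ → Polynomial ℕ → Polynomial ℕ := fun n b =>
    n * 2 + 1 + (b * 2 + 1 + ((n + b + 1) * 4 + 2 + 1 + 1)) +
    ((n + b + 1) * (n * 4 + 2 + 2) + 2 +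
    (n * (((n * (n + 1) + 1) * (n * 6 + 9) + 3) + 2) + 2 +
    (n * 4 + 2 + ((n + b + 1) * 3 + 2) +
    (n * 5 + 2 + (2 + (b * 4 + 2 + 2)) + ((n + b + 1) * ((n * 5 + 3) + 2) + 2 + 2)))))
  exact ⟨k .X .X, fun N => by simp [k, kernelTime]⟩

end RAM

/-! ### The encoding as a matrix -/

open Classical in
/-- The bit matrix of an instance: the adjacency matrix, followed by the rows that give the positions
of the boundary vertices and by the indicator vector of the cover. -/
noncomputable def VCInstance.matrix {b : ℕ} (x : VCInstance b) (r c : ℕ) : Bool :=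
  if hc : c < x.n then
    if hr : r < x.n then decide (x.G.graph.Adj ⟨r, hr⟩ ⟨c, hc⟩)
    else if hb : r - x.n < b then decide (x.G.bd ⟨r - x.n, hb⟩ = ⟨c, hc⟩)
    else decide (⟨c, hc⟩ ∈ x.cover)
  else false

namespace VCInstance

variable {b : ℕ} (x : VCInstance b)

theorem matrix_adj (u v : Fin x.n) : x.matrix u v = true ↔ x.G.graph.Adj u v := by
  simp [matrix]

theorem matrix_bd (i : Fin b) (v : Fin x.n) : x.matrix (x.n + i) v = true ↔ x.G.bd i = v := by
  simp [matrix]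

theorem matrix_cover (v : Fin x.n) : x.matrix (x.n + b) v = true ↔ v ∈ x.cover := by
  simp [matrix]

/-- The columns in `s` of the rows that are in `s` or beyond the adjacency matrix. -/
theorem matrix_rows (s : ℕ → Bool) (hs : ∀ r, x.n ≤ r → r < x.n + b + 1 → s r = true) (l : List ℕ) :
    ((List.range (x.n + b + 1)).filter s).flatMap (fun r => l.map (x.matrix r)) =
      ((List.range x.n).filter s).flatMap (fun r => l.map (x.matrix r)) ++
        (List.range b).flatMap (fun i => l.map (x.matrix (x.n + i))) ++
        l.map (x.matrix (x.n + b)) := by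
  have h₁ : ((List.range b).map (x.n + ·)).filter s = (List.range b).map (x.n + ·) := by
    refine List.filter_eq_self.2 fun r hr => ?_
    obtain ⟨i, hi, rfl⟩ := List.mem_map.1 hr
    have := List.mem_range.1 hi
    exact hs _ (by omega) (by omega)
  have h₂ : [x.n + b].filter s = [x.n + b] := by
    refine List.filter_eq_self.2 fun r hr => ?_
    obtain rfl := List.mem_singleton.1 hr
    exact hs _ (by omega) (by omega)
  rw [List.range_succ, List.range_add, List.filter_append, List.filter_append, h₁, h₂]
  simp [List.flatMap_append, List.flatMap_map]

-- The three blocks all have rows of length `n`, so together they form one flattened matrix.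
open Classical in
theorem encode_eq : x.encode = List.replicate x.n true ++ [false] ++ List.replicate b true ++ [false] ++
    (List.range (x.n + b + 1)).flatMap (fun r => (List.range x.n).map (x.matrix r)) := by
  have h := x.matrix_rows (fun _ => true) (fun _ _ _ => rfl) (List.range x.n)
  simp only [List.filter_true] at h
  rw [h]
  simp only [← List.map_coe_finRange_eq_range, List.flatMap_map, List.map_map, Function.comp_def]
  have h₁ : ∀ u v : Fin x.n, x.matrix u v = decide (x.G.graph.Adj u v) := by simp [matrix]
  have h₂ : ∀ (i : Fin b) (v : Fin x.n), x.matrix (x.n + i) v = decide (x.G.bd i = v) := by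
    simp [matrix]
  have h₃ : ∀ v : Fin x.n, x.matrix (x.n + b) v = decide (v ∈ x.cover) := by simp [matrix]
  simp only [h₁, h₂, h₃, encode, List.append_assoc]

theorem length_flatMap_map_range {α : Type} (f : ℕ → ℕ → α) (m n : ℕ) :
    ((List.range m).flatMap fun r => (List.range n).map (f r)).length = m * n := by
  simp [List.length_flatMap]

theorem getElem?_flatMap_map_range {α : Type} (f : ℕ → ℕ → α) {m n r c : ℕ} (hr : r < m)
    (hc : c < n) :
    ((List.range m).flatMap fun r => (List.range n).map (f r))[r * n + c]? = some (f r c) := by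
  induction m with
  | zero => omega
  | succ m ih =>
    rw [List.range_succ, List.flatMap_append, List.flatMap_singleton]
    rcases (Nat.lt_succ_iff.1 hr).lt_or_eq with h | rfl
    · rw [List.getElem?_append_left, ih h]
      rw [length_flatMap_map_range]
      nlinarith
    · rw [List.getElem?_append_right] <;> rw [length_flatMap_map_range]
      · simp [hc]
      · omega

theorem length_encode : x.encode.length = x.n + b + 2 + (x.n + b + 1) * x.n := by
  rw [encode_eq, List.length_append, length_flatMap_map_range]
  simp
  omega

theorem isMatrixInput_encode : RAM.IsMatrixInput x.n b x.matrix x.encode := by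
  have hlen : (List.replicate x.n true ++ [false] ++ List.replicate b true ++ [false]).length =
      x.n + b + 2 := by
    simp
    omega
  refine ⟨?_, ?_, ?_, ?_, ?_⟩
  · intro i hi
    rw [encode_eq]
    simp [List.getElem?_append, hi]
  · rw [encode_eq]
    simp
  · intro i hi
    rw [encode_eq]
    simp only [List.append_assoc]
    rw [List.getElem?_append_right (by simp; omega), List.getElem?_append_right (by simp; omega),
      List.getElem?_append_left (by simp; omega), List.getElem?_replicate, if_pos (by simp; omega)]
  · rw [encode_eq]
    simp only [List.append_assoc]
    rw [List.getElem?_append_right (by simp; omega), List.getElem?_append_right (by simp; omega),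
      List.getElem?_append_right (by simp; omega)]
    have : x.n + 1 + b - x.n - 1 - b = 0 := by omega
    simp [this]
  · intro r hr c hc
    rw [encode_eq, List.getElem?_append_right (by omega), hlen,
      ← getElem?_flatMap_map_range x.matrix hr hc]
    congr 1
    omega

/-! ### Restriction to a set of vertices -/

/-- The instance induced by a set of vertices that contains the boundary. -/
def restrict (S : Finset (Fin x.n)) (hS : ∀ i, x.G.bd i ∈ S) : VCInstance b where
  n := S.card
  G :=
    { graph := x.G.graph.comap (S.orderEmbOfFin rfl)
      bd := ⟨fun i => (S.orderIsoOfFin rfl).symm ⟨x.G.bd i, hS i⟩, fun i j h => by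
        simpa using h⟩ }
  cover := {v | S.orderEmbOfFin rfl v ∈ x.cover}
  isCover := fun u v h => by simpa using x.isCover h

variable (S : Finset (Fin x.n)) (hS : ∀ i, x.G.bd i ∈ S)

theorem restrict_bd (i : Fin b) : S.orderEmbOfFin rfl ((x.restrict S hS).G.bd i) = x.G.bd i := by
  change ((S.orderIsoOfFin rfl ((S.orderIsoOfFin rfl).symm ⟨x.G.bd i, hS i⟩) : S) : Fin x.n) = _
  simp

theorem mem_cover_restrict (v : Fin S.card) :
    v ∈ (x.restrict S hS).cover ↔ S.orderEmbOfFin rfl v ∈ x.cover :=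
  Finset.mem_filter.trans (and_iff_right (Finset.mem_univ _))

theorem card_cover_restrict_le : (x.restrict S hS).cover.card ≤ x.cover.card := by
  refine Finset.card_le_card_of_injOn (S.orderEmbOfFin rfl) (fun v hv => ?_)
    (S.orderEmbOfFin rfl).injective.injOn
  exact (x.mem_cover_restrict S hS v).1 hv

/-- Both lists are strictly increasing with the same members; this is why `restrict` renumbers `S`
in increasing order. -/
theorem map_orderEmbOfFin_range {n : ℕ} (S : Finset (Fin n)) (K : ℕ → Bool)
    (hK : ∀ v : Fin n, K v = true ↔ v ∈ S) :
    (List.range n).filter K = (List.finRange S.card).map fun v => (S.orderEmbOfFin rfl v : ℕ) := by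
  have h₁ : ((List.range n).filter K).Pairwise (· < ·) := List.pairwise_lt_range.filter _
  have h₂ : ((List.finRange S.card).map fun v => (S.orderEmbOfFin rfl v : ℕ)).Pairwise (· < ·) := by
    rw [List.pairwise_map]
    exact (List.pairwise_lt_finRange S.card).imp fun h => (S.orderEmbOfFin rfl).strictMono h
  refine List.Perm.eq_of_pairwise (le := (· < ·)) (fun a b _ _ h h' => absurd h (lt_asymm h'))
    h₁ h₂ ((List.perm_ext_iff_of_nodup (h₁.imp ne_of_lt) (h₂.imp ne_of_lt)).2 fun a => ?_)
  simp only [List.mem_filter, List.mem_range, List.mem_map, List.mem_finRange, true_and]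
  constructor
  · rintro ⟨ha, haK⟩
    have : (⟨a, ha⟩ : Fin n) ∈ Set.range (S.orderEmbOfFin rfl) := by
      rw [Finset.range_orderEmbOfFin]
      exact (hK ⟨a, ha⟩).1 haK
    obtain ⟨v, hv⟩ := this
    exact ⟨v, by rw [hv]⟩
  · rintro ⟨v, rfl⟩
    exact ⟨Fin.isLt _, (hK _).2 (Finset.orderEmbOfFin_mem _ _ _)⟩

theorem encode_restrict (K : ℕ → Bool) (hK : ∀ v : Fin x.n, K v = true ↔ v ∈ S)
    (hK' : ∀ r, x.n ≤ r → r < x.n + b + 1 → K r = true) :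
    (x.restrict S hS).encode =
      List.replicate ((List.range x.n).filter K).length true ++ [false] ++
        List.replicate b true ++ [false] ++
        ((List.range (x.n + b + 1)).filter K).flatMap
          fun r => ((List.range x.n).filter K).map (x.matrix r) := by
  rw [x.matrix_rows K hK', map_orderEmbOfFin_range S K hK]
  have h := (x.restrict S hS).matrix_rows (fun _ => true) (fun _ _ _ => rfl)
    (List.range (x.restrict S hS).n)
  simp only [List.filter_true] at h
  rw [encode_eq, h]
  simp only [← List.map_coe_finRange_eq_range, List.flatMap_map, List.map_map, Function.comp_def]
  have h₁ : ∀ u v : Fin S.card, (x.restrict S hS).matrix u v =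
      x.matrix (S.orderEmbOfFin rfl u) (S.orderEmbOfFin rfl v) := by
    intro u v
    rw [Bool.eq_iff_iff, matrix_adj, (x.restrict S hS).matrix_adj u v]
    rfl
  have h₂ : ∀ (i : Fin b) (v : Fin S.card),
      (x.restrict S hS).matrix ((x.restrict S hS).n + i) v =
        x.matrix (x.n + i) (S.orderEmbOfFin rfl v) := by
    intro i v
    rw [Bool.eq_iff_iff, matrix_bd, (x.restrict S hS).matrix_bd i v, ← x.restrict_bd S hS i]
    exact ((S.orderEmbOfFin rfl).injective.eq_iff).symm
  have h₃ : ∀ v : Fin S.card, (x.restrict S hS).matrix ((x.restrict S hS).n + b) v =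
      x.matrix (x.n + b) (S.orderEmbOfFin rfl v) := by
    intro v
    rw [Bool.eq_iff_iff, matrix_cover, (x.restrict S hS).matrix_cover v]
    exact x.mem_cover_restrict S hS v
  have e₁ := List.flatMap_congr (l := List.finRange S.card) fun u _ =>
    List.map_congr_left (l := List.finRange S.card) fun v _ => h₁ u v
  have e₂ := List.flatMap_congr (l := List.finRange b) fun i _ =>
    List.map_congr_left (l := List.finRange S.card) fun v _ => h₂ i v
  have e₃ := List.map_congr_left (l := List.finRange S.card) fun v _ => h₃ v
  rw [List.length_map, List.length_finRange]
  exact congrArg _ (congrArg₂ _ (congrArg₂ _ e₁ e₂) e₃)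

end VCInstance

/-! ### Removing vertices next to a crown -/

theorem vcOpt_le_vcOpt {V W : Type} [Finite V] [Finite W] {G : SimpleGraph V} {H : SimpleGraph W}
    (h : ∀ s : Set W, H.IsVertexCover s → ∃ t : Set V, G.IsVertexCover t ∧ t.encard ≤ s.encard) :
    vcOpt G ≤ vcOpt H := by
  obtain ⟨s, hs, hc⟩ := H.vertexCoverNum_exists
  obtain ⟨t, ht, hle⟩ := h s hc
  exact ENat.toNat_le_toNat (ht.vertexCoverNum_le.trans (hle.trans hs.le))
    SimpleGraph.vertexCoverNum_ne_top_of_finite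

namespace BoundariedGraph

variable {B V V' W : Type} {G : BoundariedGraph B V} {G' : BoundariedGraph B V'} {e : V' ↪ V}

theorem glue_adj_map (hadj : ∀ u v, G'.graph.Adj u v ↔ G.graph.Adj (e u) (e v))
    (hbd : ∀ i, e (G'.bd i) = G.bd i) (H : BoundariedGraph B W)
    (a c : V' ⊕ {w : W // w ∉ Set.range H.bd}) :
    (G'.glue H).Adj a c ↔ (G.glue H).Adj (Sum.map e id a) (Sum.map e id c) := by
  have hb : ∀ i v, G.bd i = e v ↔ G'.bd i = v := fun i v => by rw [← hbd, e.injective.eq_iff]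
  rcases a with u | w <;> rcases c with v | w' <;> simp [glue, GlueAdj, hadj, hb]

/-- Off the boundary, gluing creates no edges; this makes the crown argument uniform in `H`. -/
theorem adj_of_glue_adj {v : V} (hv : v ∉ Set.range G.bd) {H : BoundariedGraph B W}
    {a : V ⊕ {w : W // w ∉ Set.range H.bd}} (h : (G.glue H).Adj (Sum.inl v) a) :
    ∃ y, a = Sum.inl y ∧ G.graph.Adj v y := by
  rcases a with y | w
  · rcases h with h | ⟨i, j, hi, -⟩
    · exact ⟨y, rfl, h⟩
    · exact absurd ⟨i, hi⟩ hv
  · obtain ⟨i, hi, -⟩ := h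
    exact absurd ⟨i, hi⟩ hv

/-- Let `f` match the vertices of `R` to vertices off the boundary all of whose neighbours are in
`R`. Then vertices off `R`, the boundary and `f '' R` can be removed if all their neighbours are
in `R`. -/
theorem vcGluingEquiv_of_crown [Finite V] [Finite V']
    (hadj : ∀ u v, G'.graph.Adj u v ↔ G.graph.Adj (e u) (e v))
    (hbd : ∀ i, e (G'.bd i) = G.bd i) {R : Set V} {f : V → V} (hR : R ⊆ Set.range e)
    (hfe : ∀ u ∈ R, f u ∈ Set.range e) (hfR : ∀ u ∈ R, f u ∉ R)
    (hinj : Set.InjOn f R) (hf : ∀ u ∈ R, G.graph.Adj u (f u))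
    (hfbd : ∀ u ∈ R, f u ∉ Set.range G.bd) (hfN : ∀ u ∈ R, ∀ y, G.graph.Adj (f u) y → y ∈ R)
    (hrem : ∀ v ∉ Set.range e, ∀ y, G.graph.Adj v y → y ∈ R) : VCGluingEquiv G G' 0 := by
  classical
  intro W _ H
  rw [add_zero, Nat.cast_inj]
  have hmap := glue_adj_map hadj hbd H
  apply le_antisymm
  · refine vcOpt_le_vcOpt fun Y hY => ?_
    -- The exchange: `g` moves each `f u` to `u` and fixes everything else, so the image of a cover
    -- is no larger.
    let g : V' ⊕ {w : W // w ∉ Set.range H.bd} → V ⊕ {w : W // w ∉ Set.range H.bd} :=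
      Sum.map (fun v => if h : ∃ u ∈ R, f u = e v then h.choose else e v) id
    refine ⟨g '' Y, ?_, Set.encard_image_le g Y⟩
    have hg₁ : ∀ u ∈ R, ∀ v, f u = e v → g (Sum.inl v) = Sum.inl u := by
      intro u hu v huv
      have h : ∃ u ∈ R, f u = e v := ⟨u, hu, huv⟩
      have hc : h.choose = u := hinj h.choose_spec.1 hu (h.choose_spec.2.trans huv.symm)
      simp [g, dif_pos h, hc]
    have hg₂ : ∀ a, (∀ u ∈ R, Sum.inl (f u) ≠ Sum.map e id a) → g a = Sum.map e id a := by
      rintro (v | w) h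
      · have : ¬ ∃ u ∈ R, f u = e v := fun ⟨u, hu, huv⟩ => h u hu (by simp [huv])
        simp [g, dif_neg this]
      · rfl
    -- `Y` contains an end of the edge from `u` to `f u`, and `g` sends both ends to `u`.
    have hgR : ∀ u ∈ R, Sum.inl u ∈ g '' Y := by
      intro u hu
      obtain ⟨v, rfl⟩ := hR hu
      obtain ⟨v', hv'⟩ := hfe _ hu
      have : (G'.glue H).Adj (Sum.inl v) (Sum.inl v') := by
        refine Or.inl ((hadj _ _).2 ?_)
        rw [hv']
        exact hf _ hu
      rcases hY this with h | h
      · refine ⟨_, h, hg₂ _ fun u' hu' heq => hfR u' hu' ?_⟩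
        rw [Sum.inl_injective heq]
        exact hu
      · exact ⟨_, h, hg₁ _ hu _ hv'.symm⟩
    -- Removed vertices and those in `f '' R` have all their neighbours in `R`; all others come from
    -- the smaller graph and are fixed by `g`.
    have hdich : ∀ a : V ⊕ {w : W // w ∉ Set.range H.bd},
        (∀ c, (G.glue H).Adj a c → c ∈ g '' Y) ∨
          ∃ a', a = Sum.map e id a' ∧ g a' = Sum.map e id a' := by
      rintro (v | w)
      · by_cases hv : v ∈ Set.range e
        · obtain ⟨v', rfl⟩ := hv
          by_cases h : ∃ u ∈ R, f u = e v'
          · obtain ⟨u, hu, huv⟩ := h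
            left
            intro c hc
            obtain ⟨y, rfl, hy⟩ := adj_of_glue_adj (huv ▸ hfbd u hu) hc
            exact hgR y (hfN u hu y (huv ▸ hy))
          · exact .inr ⟨.inl v', rfl, hg₂ _ fun u hu heq => h ⟨u, hu, Sum.inl_injective heq⟩⟩
        · left
          intro c hc
          have : v ∉ Set.range G.bd := by
            rintro ⟨i, rfl⟩
            exact hv ⟨_, hbd i⟩
          obtain ⟨y, rfl, hy⟩ := adj_of_glue_adj this hc
          exact hgR y (hrem v hv y hy)
      · exact .inr ⟨.inr w, rfl, rfl⟩
    intro a c hac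
    rcases hdich a with h | ⟨a', rfl, ha'⟩
    · exact .inr (h c hac)
    rcases hdich c with h | ⟨c', rfl, hc'⟩
    · exact .inl (h _ hac.symm)
    rcases hY ((hmap a' c').2 hac) with h | h
    · exact .inl ⟨a', h, ha'⟩
    · exact .inr ⟨c', h, hc'⟩
  · refine vcOpt_le_vcOpt fun Y hY => ⟨Sum.map e id ⁻¹' Y, fun a c h => hY ((hmap a c).1 h), ?_⟩
    have hinj : Function.Injective (Sum.map e id :
        V' ⊕ {w : W // w ∉ Set.range H.bd} → V ⊕ {w : W // w ∉ Set.range H.bd}) :=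
      e.injective.sumMap Function.injective_id
    rw [← hinj.encard_image]
    exact Set.encard_le_encard (Set.image_preimage_subset _ _)

end BoundariedGraph

/-! ### The kernelization -/

namespace VCInstance

variable {b : ℕ} (x : VCInstance b)

/-- The vertices of the cover and of the boundary. -/
def terminals : Finset (Fin x.n) := x.cover ∪ Finset.univ.map x.G.bd

theorem mem_terminals {v : Fin x.n} :
    v ∈ x.terminals ↔ v ∈ x.cover ∨ v ∈ Set.range x.G.bd := by
  simp [terminals]

theorem card_terminals_le : x.terminals.card ≤ b + x.cover.card := by
  refine (Finset.card_union_le _ _).trans ?_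
  simp [add_comm]

theorem mem_terminals_iff_matrix (c : ℕ) (hc : c < x.n) :
    (⟨c, hc⟩ : Fin x.n) ∈ x.terminals ↔
      ∃ r, x.n ≤ r ∧ r < x.n + b + 1 ∧ x.matrix r c = true := by
  rw [mem_terminals]
  constructor
  · rintro (h | ⟨i, hi⟩)
    · exact ⟨x.n + b, by omega, by omega, (x.matrix_cover ⟨c, hc⟩).2 h⟩
    · exact ⟨x.n + i, by omega, by omega, (x.matrix_bd i ⟨c, hc⟩).2 hi⟩
  · rintro ⟨r, hr, hr', h⟩
    obtain ⟨i, rfl⟩ := Nat.exists_eq_add_of_le hr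
    rcases (show i ≤ b by omega).lt_or_eq with hi | rfl
    · exact .inr ⟨⟨i, hi⟩, (x.matrix_bd ⟨i, hi⟩ ⟨c, hc⟩).1 h⟩
    · exact .inl ((x.matrix_cover ⟨c, hc⟩).1 h)

/-- When all vertices are settled, the terminals and the matched vertices induce an equivalent
instance: for a price `j` that no vertex has, the vertices of price greater than `j` and their
partners form a crown. -/
theorem exists_crown {mt lv : ℕ → ℕ}
    (hA : RAM.Auction x.n x.matrix (fun c => ∃ hc : c < x.n, ⟨c, hc⟩ ∈ x.terminals) mt lv)
    (hset : ∀ z < x.n, (¬ ∃ hz : z < x.n, ⟨z, hz⟩ ∈ x.terminals) →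
      RAM.Settled x.n x.matrix mt lv z)
    (S : Finset (Fin x.n)) (hS : ∀ i, x.G.bd i ∈ S)
    (hmem : ∀ v : Fin x.n, v ∈ S ↔ v ∈ x.terminals ∨ ∃ u < x.n, mt u = v + 1) :
    VCGluingEquiv x.G (x.restrict S hS).G 0 ∧ S.card ≤ 2 * (b + x.cover.card) := by
  classical
  let f : Fin x.n → Fin x.n := fun u => if h : mt u - 1 < x.n then ⟨mt u - 1, h⟩ else u
  have hcov : ∀ u v : Fin x.n, x.G.graph.Adj u v → v ∉ x.terminals → u ∈ x.terminals := by
    intro u v h hv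
    rw [mem_terminals] at hv ⊢
    rcases x.isCover h with hu | hv'
    · exact .inl hu
    · exact absurd (.inl hv') hv
  have hf : ∀ u v : Fin x.n, mt u = v + 1 → f u = v := by
    intro u v h
    have h' : mt u - 1 < x.n := by omega
    simp only [f, dif_pos h']
    exact Fin.ext (by simp [h])
  have hmatch : ∀ u : Fin x.n, mt u ≠ 0 →
      mt u = f u + 1 ∧ f u ∉ x.terminals ∧ x.G.graph.Adj u (f u) := by
    intro u hu
    obtain ⟨y, hy, hyu, hyT, hM⟩ := hA.edge u u.2 hu
    have hfu : f u = ⟨y, hy⟩ := hf u ⟨y, hy⟩ hyu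
    rw [hfu]
    exact ⟨hyu, fun h => hyT ⟨hy, h⟩, ((x.matrix_adj ⟨y, hy⟩ u).1 hM).symm⟩
  constructor
  -- Pigeonhole: `n + 1` possible prices below the cap, but only `n` vertices.
  · obtain ⟨j, hj, hgap⟩ : ∃ j < x.n + 1, ∀ u < x.n, lv u ≠ j := by
      by_contra! h
      have := Finset.card_le_card (s := Finset.range (x.n + 1))
        (t := (Finset.range x.n).image lv) (fun j hj => by simpa using h j (by simpa using hj))
      have := this.trans Finset.card_image_le
      simp at this
    have hpos : ∀ u : Fin x.n, j < lv u → mt u ≠ 0 := fun u hu =>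
      hA.matched u u.2 (by omega)
    have hRT : ∀ u : Fin x.n, j < lv u → u ∈ x.terminals := by
      intro u hu
      obtain ⟨-, h₁, h₂⟩ := hmatch u (hpos u hu)
      exact hcov _ _ h₂ h₁
    refine BoundariedGraph.vcGluingEquiv_of_crown (e := (S.orderEmbOfFin rfl).toEmbedding)
      (R := {u | j < lv u}) (f := f) (fun _ _ => Iff.rfl) (fun i => x.restrict_bd S hS i)
      ?_ ?_ ?_ ?_ ?_ ?_ ?_ ?_
    · intro u hu
      change u ∈ Set.range (S.orderEmbOfFin rfl)
      rw [Finset.range_orderEmbOfFin]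
      exact (hmem u).2 (.inl (hRT u hu))
    · intro u hu
      change f u ∈ Set.range (S.orderEmbOfFin rfl)
      rw [Finset.range_orderEmbOfFin]
      exact (hmem _).2 (.inr ⟨u, u.2, (hmatch u (hpos u hu)).1⟩)
    · intro u hu hfu
      exact (hmatch u (hpos u hu)).2.1 (hRT _ hfu)
    · intro u hu u' hu' h
      refine Fin.ext (hA.inj u u.2 u' u'.2 (hpos u hu) ?_)
      rw [(hmatch u (hpos u hu)).1, (hmatch u' (hpos u' hu')).1, h]
    · intro u hu
      exact (hmatch u (hpos u hu)).2.2
    · intro u hu h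
      exact (hmatch u (hpos u hu)).2.1 (x.mem_terminals.2 (.inr h))
    · intro u hu y hy
      -- The price of `y` is at least `lv u - 1 ≥ j` and differs from `j`.
      have := hA.slack u u.2 _ (hmatch u (hpos u hu)).1 y y.2 ((x.matrix_adj _ y).2 hy)
      have := hgap y y.2
      have hu : j < lv u := hu
      change j < lv y
      omega
    · intro v hv y hy
      have hv : v ∉ S := by
        intro h
        apply hv
        change v ∈ Set.range (S.orderEmbOfFin rfl)
        rwa [Finset.range_orderEmbOfFin]
      rw [hmem, not_or] at hv
      rcases hset v v.2 (fun ⟨_, h⟩ => hv.1 h) with h | h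
      · exact absurd h hv.2
      -- A discarded vertex sees only prices at the cap `n + 1 > j`.
      · have := h y y.2 ((x.matrix_adj v y).2 hy)
        change j < lv y
        omega
  -- Each matched non-terminal is the partner of a terminal, as non-terminals are independent.
  · have hsub : S ⊆ x.terminals ∪ x.terminals.image f := by
      intro v hv
      rcases (hmem v).1 hv with h | ⟨u, hu, huv⟩
      · exact Finset.mem_union_left _ h
      · have hfu := hf ⟨u, hu⟩ v huv
        obtain ⟨-, h₁, h₂⟩ := hmatch ⟨u, hu⟩ (by simp [huv])
        exact Finset.mem_union_right _ (Finset.mem_image.2 ⟨_, hcov _ _ h₂ h₁, hfu⟩)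
    have h₁ := (Finset.card_le_card hsub).trans (Finset.card_union_le _ _)
    have h₂ : (x.terminals.image f).card ≤ x.terminals.card := Finset.card_image_le
    have h₃ := x.card_terminals_le
    omega

theorem exists_kernel : ∃ y : VCInstance b,
    VCGluingEquiv x.G y.G 0 ∧ y.n ≤ 2 * (b + x.cover.card) ∧ y.cover.card ≤ x.cover.card ∧
      RAM.Runs RAM.kernelProg (RAM.Store.init x.encode) (RAM.kernelTime x.n b)
        (fun s => s.HasOutput (y.encode ++ encodeInt 0)) := by
  obtain ⟨K, mt, lv, hA, hset, hK, hK', hrun⟩ := RAM.runs_kernelProg x.isMatrixInput_encode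
    (T := fun c => ∃ hc : c < x.n, ⟨c, hc⟩ ∈ x.terminals) (fun c hc => by
      rw [← x.mem_terminals_iff_matrix c hc]
      exact exists_prop_of_true hc)
  let S : Finset (Fin x.n) := {v | K v = true}
  have hKS : ∀ v : Fin x.n, K v = true ↔ v ∈ S := by simp [S]
  have hmem : ∀ v : Fin x.n, v ∈ S ↔ v ∈ x.terminals ∨ ∃ u < x.n, mt u = v + 1 := by
    intro v
    rw [← hKS, hK v v.2]
    simp
  have hS : ∀ i, x.G.bd i ∈ S := fun i => (hmem _).2 (.inl (x.mem_terminals.2 (.inr ⟨i, rfl⟩)))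
  obtain ⟨hequiv, hcard⟩ := x.exists_crown hA hset S hS hmem
  refine ⟨x.restrict S hS, hequiv, hcard, x.card_cover_restrict_le S hS, ?_⟩
  rw [x.encode_restrict S hS K hKS hK']
  -- `encodeInt 0` reduces to `[false]`, the last bit emitted.
  exact hrun

end VCInstance

/-! ### The main theorem. -/

theorem mainTheorem3 :
    ∃ f : ∀ b : ℕ, VCInstance b → VCInstance b × ℤ,
      IsPolyBoundariedKernelization f ∧
        ∀ (b : ℕ) (x : VCInstance b), (f b x).1.n ≤ 2 * (b + x.cover.card) := by
  -- The kernel is picked by choice, but `hrun` says that the one program `kernelProg` outputs its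
  -- encoding.
  choose y hequiv hn hcover hrun using fun (b : ℕ) (x : VCInstance b) => x.exists_kernel
  refine ⟨fun b x => (y b x, 0), ⟨?_, hequiv, ?_⟩, hn⟩
  · obtain ⟨p, hp⟩ := RAM.exists_polynomial_kernelTime
    refine ⟨RAM.kernelProg, p, fun ⟨b, x⟩ => ?_⟩
    obtain ⟨t, s, he, ht, hs⟩ := hrun b x
    have hlen := x.length_encode
    have hmono := RAM.kernelTime_mono (n := x.n) (b := b) (N := x.encode.length) (by omega)
      (by omega)
    exact ⟨t, s, he, (ht.trans hmono).trans (hp _).ge, hs⟩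
  -- The formula of `length_encode` with `2 * X` for the number of vertices and `X` for `b`.
  · refine ⟨2 * .X + .X + 2 + (2 * .X + .X + 1) * (2 * .X), fun b x => ⟨?_, ?_⟩⟩
    · have hb : b ≤ b + x.cover.card := Nat.le_add_right _ _
      rw [VCInstance.length_encode]
      simp only [Polynomial.eval_add, Polynomial.eval_mul, Polynomial.eval_X, Polynomial.eval_ofNat,
        Polynomial.eval_one]
      gcongr <;> exact hn b x
    · refine (hcover b x).trans ?_
      simp only [Polynomial.eval_add, Polynomial.eval_mul, Polynomial.eval_X, Polynomial.eval_ofNat,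
        Polynomial.eval_one]
      omega
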